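/- Structures may have an empty domain. Let $\mathcal{LO}_p$, $\mathcal{LO}_{sp}$, $\mathcal{LO}_r$, $\mathcal{LO}_{sr}$ be the classes of linearly ordered sets $(A,\le,f)$ with one unary operation $f$ that is, respectively, order preserving ($a\le b\Rightarrow f(a)\le f(b)$), strict order preserving ($a<b\Rightarrow f(a)<f(b)$), order reversing ($a\le b\Rightarrow f(a)\ge f(b)$), strict order reversing ($a<b\Rightarrow f(a)>f(b)$). For a set $F=F_1\cup F_2\cup F_3\cup F_4$ of unary function symbols, let $\mathcal{PO}_F$ be the class of partially ordered sets with unary operations indexed by $F$, such that the symbols in $F_1$, $F_2$, $F_3$, $F_4$ are interpreted by order preserving, order reversing, strict order preserving, strict order reversing operations, respectively. A $1$-universal sentence is a sentence $\forall x\,\psi(x)$ with $\psi$ quantifier-free and with no variable other than $x$. For a set $H$ of $1$-universal sentences in the language of $\mathcal K$, let $\mathcal K^H$ be the class of members of $\mathcal K$ satisfying all sentences in $H$. A Fraïssé limit of a class $\mathcal F$ of finitely generated structures is a countable ultrahomogeneous structure whose age (the class of all finitely generated structures embeddable in it) is $\mathcal F$. **Theorem 5.2.** Let $H$ be any, possibly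 empty, set of $1$-universal sentences. (1) Let $\mathcal K$ be $\mathcal{LO}_p^H$, or $\mathcal{LO}_r^H$, or $\mathcal{PO}_F^H$ with $F$ finite, and let $\mathcal K^{fin}$ be the class of finite members of $\mathcal K$. If $\mathcal K^{fin}$ is not empty, then $\mathcal K^{fin}$ has a Fraïssé limit $\mathbf M$ which belongs to $\mathcal K$. If, moreover, $\mathcal K$ is $\mathcal{LO}_p^H$ or $\mathcal{LO}_r^H$ and $H$ includes the sentence $\forall x\, f^{m+2}(x)=f^m(x)$ for some $m\in\mathbb N$, then the first-order theory $Th(\mathbf M)$ is $\omega$-categorical (any two models of cardinality $\aleph_0$ are isomorphic), has quantifier elimination, and is a model completion of $Th(\mathcal K)$, the set of sentences true in all members of $\mathcal K$: every model of $Th(\mathbf M)$ is a model of $Th(\mathcal K)$, every model of $Th(\mathcal K)$ embeds in a model of $Th(\mathbf M)$, and, for every model $\mathbf A$ of $Th(\mathcal K)$, the theory $Th(\mathbf M)$ together with the diagram of $\mathbf A$ is complete. (2) Let $\mathcal K$ be $\mathcal{LO}_p^H$, $\mathcal{LO}_{sp}^H$, $\mathcal{LO}_r^H$ or $\mathcal{LO}_{sr}^H$.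 If $\mathcal K$ is not empty, then the class $\mathcal K^{fg}$ of finitely generated members of $\mathcal K$ has a Fraïssé limit which belongs to $\mathcal K$. -/

import Mathlib

open FirstOrder FirstOrder.Language CategoryTheory

namespace OrdOp

/-- Function symbols: one unary symbol for each element of `F`, and no others. -/
inductive OpFun (F : Type) : ℕ → Type
  | op : F → OpFun F 1

/-- The language with one binary relation symbol `≤` and an `F`-indexed family of unary function
symbols. -/
def lang (F : Type) : FirstOrder.Language.{0, 0} := ⟨OpFun F, orderRel⟩

instance (F : Type) : IsOrdered (lang F) := ⟨orderRel.le⟩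

instance (F : Type) [Countable F] : Countable (Σ l, (lang F).Functions l) := by
  refine Function.Surjective.countable (f := fun i : F => ⟨1, OpFun.op i⟩) ?_
  rintro ⟨_, ⟨i⟩⟩
  exact ⟨i, rfl⟩

/-- The unary function symbol attached to `i`. -/
def opSymb {F : Type} (i : F) : (lang F).Functions 1 := OpFun.op i

section Interpretation

variable {F : Type} (A : Type) [(lang F).Structure A]

/-- The interpretation of the symbol `≤`. -/
def le (a b : A) : Prop := Structure.RelMap (leSymb : (lang F).Relations 2) ![a, b]

/-- The strict relation `<` attached to the interpretation of `≤`. -/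
def lt (a b : A) : Prop := le (F := F) A a b ∧ a ≠ b

/-- The interpretation of the unary function symbol attached to `i`. -/
def op (i : F) (a : A) : A := Structure.funMap (opSymb i) ![a]

/-- `a ≤ b` implies `f a ≤ f b`. -/
def OrderPreserving (i : F) : Prop :=
  ∀ a b : A, le (F := F) A a b → le (F := F) A (op A i a) (op A i b)

/-- `a ≤ b` implies `f a ≥ f b`. -/
def OrderReversing (i : F) : Prop :=
  ∀ a b : A, le (F := F) A a b → le (F := F) A (op A i b) (op A i a)

/-- `a < b` implies `f a < f b`. -/
def StrictOrderPreserving (i : F) : Prop :=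
  ∀ a b : A, lt (F := F) A a b → lt (F := F) A (op A i a) (op A i b)

/-- `a < b` implies `f a > f b`. -/
def StrictOrderReversing (i : F) : Prop :=
  ∀ a b : A, lt (F := F) A a b → lt (F := F) A (op A i b) (op A i a)

end Interpretation

/-- Classes of structures; the carriers may be empty. -/
abbrev StrClass (L : FirstOrder.Language.{0, 0}) := Set (Bundled.{0} L.Structure)

/-- Linearly ordered sets with an order preserving unary operation. -/
def LOp : StrClass (lang Unit) :=
  {A | IsLinearOrder A (le (F := Unit) A) ∧ OrderPreserving A ()}

/-- Linearly ordered sets with a strict order preserving unary operation. -/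
def LOsp : StrClass (lang Unit) :=
  {A | IsLinearOrder A (le (F := Unit) A) ∧ StrictOrderPreserving A ()}

/-- Linearly ordered sets with an order reversing unary operation. -/
def LOr : StrClass (lang Unit) :=
  {A | IsLinearOrder A (le (F := Unit) A) ∧ OrderReversing A ()}

/-- Linearly ordered sets with a strict order reversing unary operation. -/
def LOsr : StrClass (lang Unit) :=
  {A | IsLinearOrder A (le (F := Unit) A) ∧ StrictOrderReversing A ()}

/-- Posets with operations which are order preserving for the symbols in `F₁`, order reversing for
those in `F₂`, strict order preserving for those in `F₃`, strict order reversing for those in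
`F₄`. -/
def PO {F : Type} (F₁ F₂ F₃ F₄ : Set F) : StrClass (lang F) :=
  {A | IsPartialOrder A (le (F := F) A) ∧
    (∀ i ∈ F₁, OrderPreserving A i) ∧ (∀ i ∈ F₂, OrderReversing A i) ∧
    (∀ i ∈ F₃, StrictOrderPreserving A i) ∧ (∀ i ∈ F₄, StrictOrderReversing A i)}

variable {L : FirstOrder.Language.{0, 0}}

/-- The members of `K` satisfying all the sentences in `H`. -/
def withCond (K : StrClass L) (H : Set L.Sentence) : StrClass L :=
  {A | A ∈ K ∧ ∀ φ ∈ H, A ⊨ φ}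

/-- The finite members of `K`. -/
def finPart (K : StrClass L) : StrClass L := {A | A ∈ K ∧ Finite A}

/-- The finitely generated members of `K`. -/
def fgPart (K : StrClass L) : StrClass L := {A | A ∈ K ∧ Structure.FG L A}

/-- A sentence of the form `∀ x, ψ(x)` with `ψ` quantifier-free and without other variables. -/
def IsOneUniversal (φ : L.Sentence) : Prop :=
  ∃ ψ : L.BoundedFormula Empty 1, ψ.IsQF ∧ φ = ψ.all

/-- The term `f (f (⋯ (f x)))` with `k` occurrences of the operation. -/
def iterTerm : ℕ → (lang Unit).Term (Empty ⊕ Fin 1)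
  | 0 => Term.var (Sum.inr 0)
  | k + 1 => (opSymb ()).apply₁ (iterTerm k)

/-- The sentence `∀ x, f ^ (m + 2) (x) = f ^ m (x)`. -/
def iterSentence (m : ℕ) : (lang Unit).Sentence :=
  ((iterTerm (m + 2)).bdEqual (iterTerm m)).all

/-- The first-order theory of a class of structures: the sentences true in all its members. -/
def classTheory (K : StrClass L) : L.Theory := {φ | ∀ A ∈ K, A ⊨ φ}

/-- Quantifier elimination: modulo `T`, every formula is equivalent to a quantifier-free formula in
the same free variables. -/
def HasQE (T : L.Theory) : Prop :=
  ∀ (n : ℕ) (φ : L.Formula (Fin n)), ∃ ψ : L.Formula (Fin n), ψ.IsQF ∧ φ ⇔[T] ψ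

/-- `T'` is a model completion of `T`: it extends `T`, every model of `T` embeds in a model of
`T'`, and `T'` together with the diagram of any model `A` of `T` is complete, that is,
any two models of `T'` extending `A` satisfy the same formulas with parameters from `A`. -/
structure IsModelCompletion (T' T : L.Theory) : Prop where
  extends_base : ∀ B : Bundled.{0} L.Structure, B ⊨ T' → B ⊨ T
  exists_embedding : ∀ A : Bundled.{0} L.Structure, A ⊨ T →
    ∃ B : Bundled.{0} L.Structure, B ⊨ T' ∧ Nonempty (A ↪[L] B)
  diagram_complete : ∀ A B C : Bundled.{0} L.Structure, A ⊨ T → B ⊨ T' → C ⊨ T' →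
    ∀ (i : A ↪[L] B) (j : A ↪[L] C) (n : ℕ) (φ : L.Formula (Fin n)) (v : Fin n → A),
      φ.Realize (i ∘ v) ↔ φ.Realize (j ∘ v)

end OrdOp

/-! Everything rests on one strong amalgamation property: B and C over a common A can be amalgamated
inside a structure that is the union of their images (`UnionAmalgamation`). A universal sentence
with one variable is checked one element at a time, so such an amalgam inherits H from B and C
(`realize_of_cover`); finiteness and finite generation pass to it as well. The classes are universal
and the language has no constants, so the empty structure turns amalgamation into joint embedding.
Fraïssé's theorem (`exists_isFraisseLimit`) then needs only countability up to isomorphism, and the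
limit lies in the class because its finitely generated substructures do.

The amalgam is a quotient of `B ⊕ C` by a preorder. For posets the preorder generated by B, C and
the identification of the copies of A suffices (`unionLe`). A linear amalgam must also order b and c
lying in the same cut of A. If some iterates of b and c are separated by A, the order of b and c is
forced by the first separation, reversed at odd steps when f reverses order; so orbits are compared
lexicographically through their cuts. For a reversing f the side of the centre on which an element
lies is a further forced datum. Elements never separated are identified only when they have to be:
copies of A, the fixed point of a reversing f, and, for strict f, whatever some iterate carries to
these. All other ties are broken by putting B first, or, for reversing f, B first on the left of the
centre and C first elsewhere.

Finite structures are countably many up to isomorphism. For finitely generated linear ones, the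
isomorphism type is the table of comparisons between iterates of generators. As f² is monotone in
all cases, each comparison of two orbits is described by finitely many integers
(`exists_orbitCode`).

If f^(m+2) = f^m, a finite tuple has only finitely many possible quantifier-free types, each given
by one formula (`typeFormula`). Ultrahomogeneity makes every formula equivalent in M to a
disjunction of these, and the equivalence belongs to Th(M). Quantifier elimination, back and forth
between countable models, and completeness over diagrams follow; every model of Th(K) embeds in an
ultrapower of M, because its finitely generated substructures are finite and so embed in M. -/

namespace FraisseConstruction

-- Fraïssé's theorem

universe u v w
variable {L : FirstOrder.Language.{u, v}} {K : Set (Bundled.{w} L.Structure)}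

/-- A span `N ← left → right` with feet in `K`, to be completed to a commutative square. -/
structure Span (K : Set (Bundled.{w} L.Structure)) (N : Bundled.{w} L.Structure) where
  left : Bundled.{w} L.Structure
  right : Bundled.{w} L.Structure
  left_mem : left ∈ K
  right_mem : right ∈ K
  base : left ↪[L] N
  ext : left ↪[L] right

/-- Postcomposition of the base of a span. -/
def Span.push {N P : Bundled.{w} L.Structure} (h : N ↪[L] P) (s : Span K N) : Span K P :=
  { s with base := h.comp s.base }

/-- The span can be completed along `h`. -/
def Span.Solved {N P : Bundled.{w} L.Structure} (s : Span K N) (h : N ↪[L] P) : Prop :=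
  ∃ g : s.right ↪[L] P, g.comp s.ext = h.comp s.base

theorem Span.exists_solution (hK : Amalgamation K) {N : Bundled.{w} L.Structure} (hN : N ∈ K)
    (s : Span K N) : ∃ P ∈ K, ∃ h : N ↪[L] P, s.Solved h := by
  obtain ⟨Q, p, q, hQ, h⟩ := hK s.left N s.right s.base s.ext s.left_mem hN s.right_mem
  exact ⟨Q, hQ, p, q, h.symm⟩

/-- N is countable, it has countably many finitely generated substructures, and each has countably
many embeddings into the countably many representatives of isomorphism classes of K. Listing these
embeddings covers every extension problem over N up to isomorphism of its target. -/
theorem exists_spans [Countable (Σ l, L.Functions l)] (hK : IsFraisse K)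
    (N : Bundled.{w} L.Structure) (hN : N ∈ K) :
    ∃ t : ℕ → Span K N, ∀ (S : L.Substructure N), S.FG → ∀ T ∈ K, ∀ e : S ↪[L] T,
      ∃ k, ∀ (P : Bundled.{w} L.Structure) (h : N ↪[L] P), (t k).Solved h →
        ∃ g : T ↪[L] P, g.comp e = h.comp S.subtype := by
  obtain ⟨F, hF⟩ := hK.is_essentially_countable.exists_eq_range (hK.is_nonempty.image _)
  have hF' : ∀ T ∈ K, ∃ n, Nonempty (T ≃[L] (F n).out) := by
    intro T hT
    obtain ⟨n, hn⟩ : Quotient.mk' T ∈ Set.range F := hF ▸ ⟨T, hT, rfl⟩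
    refine ⟨n, ?_⟩
    rw [hn]
    exact Setoid.symm (Quotient.mk_out T)
  have hFK : ∀ n, (F n).out ∈ K := by
    intro n
    obtain ⟨P, hP, h⟩ : F n ∈ Quotient.mk' '' K := hF ▸ ⟨n, rfl⟩
    refine (hK.is_equiv_invariant (M := P) ?_).1 hP
    rw [← h]
    exact Setoid.symm (Quotient.mk_out P)
  have hc : ∀ T ∈ K, Countable T := fun T hT =>
    Structure.cg_iff_countable.1 (hK.FG T hT).cg
  have := hc N hN
  have := fun n => hc _ (hFK n)
  have := fun S : {S : L.Substructure N // S.FG} =>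
    ((Substructure.fg_iff_structure_fg _).1 S.2)
  have := fun (S : {S : L.Substructure N // S.FG}) n =>
    Structure.FG.countable_embedding (F n).out (this S)
  have : Countable {S : L.Substructure N // S.FG} :=
    Substructure.countable_fg_substructures_of_countable
  have : Countable (Σ (S : {S : L.Substructure N // S.FG}) (n : ℕ), S.1 ↪[L] (F n).out) :=
    inferInstance
  obtain ⟨n₀, ⟨e₀⟩⟩ := hF' N hN
  have : Nonempty (Σ (S : {S : L.Substructure N // S.FG}) (n : ℕ), S.1 ↪[L] (F n).out) :=
    ⟨⟨⟨⊤, Structure.fg_def.1 (hK.FG N hN)⟩, n₀, e₀.toEmbedding.comp (Substructure.subtype _)⟩⟩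
  obtain ⟨t, ht⟩ := exists_surjective_nat
    (Σ (S : {S : L.Substructure N // S.FG}) (n : ℕ), S.1 ↪[L] (F n).out)
  let toSpan : (Σ (S : {S : L.Substructure N // S.FG}) (n : ℕ), S.1 ↪[L] (F n).out) → Span K N :=
    fun z => ⟨Bundled.of z.1.1, (F z.2.1).out,
      hK.hereditary N hN (age.fg_substructure z.1.2), hFK _, Substructure.subtype _, z.2.2⟩
  refine ⟨fun k => toSpan (t k), ?_⟩
  intro S hS T hT e
  obtain ⟨n, ⟨i⟩⟩ := hF' T hT
  obtain ⟨k, hk⟩ := ht ⟨⟨S, hS⟩, n, i.toEmbedding.comp e⟩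
  refine ⟨k, ?_⟩
  simp only [hk]
  rintro P h ⟨g, hg⟩
  exact ⟨g.comp i.toEmbedding, hg⟩

/-- A structure in `K` together with a doubly indexed family of spans over it. -/
abbrev State (K : Set (Bundled.{w} L.Structure)) := Σ N : K, (ℕ → ℕ → Span K N.1)

/-- Bookkeeping: the k-th extension problem born at stage i is pushed along the chain and solved at
stage `Nat.pair i k`, so every problem at every stage is eventually solved. -/
theorem exists_chain [Countable (Σ l, L.Functions l)] (hK : IsFraisse K) :
    ∃ (G : ℕ → Bundled.{w} L.Structure) (_ : ∀ n, G n ∈ K) (f : ∀ n, G n ↪[L] G (n + 1)),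
      ∀ (i : ℕ) (S : L.Substructure (G i)), S.FG → ∀ T ∈ K, ∀ e : S ↪[L] T,
        ∃ (j : ℕ) (hij : i ≤ j) (g : T ↪[L] G j), g.comp e =
          (DirectedSystem.natLERec (G' := fun n => G n) f i j hij).comp S.subtype := by
  choose spans hspans using exists_spans hK
  choose sol hsol map hmap using fun (N : K) (s : Span K N.1) =>
    Span.exists_solution hK.amalgamation N.2 s
  let next : ℕ → State K → State K := fun n x =>
    -- Rows up to n hold problems already born, transported to the new structure. Later rows are
    -- placeholders: row n + 1 is correct as it stands, and the others are overwritten at each stage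
    -- until their own.
    ⟨⟨sol x.1 (x.2 n.unpair.1 n.unpair.2), hsol _ _⟩, fun i k =>
      if i ≤ n then (x.2 i k).push (map x.1 (x.2 n.unpair.1 n.unpair.2)) else
        spans _ (hsol _ _) k⟩
  obtain ⟨N₀, hN₀⟩ := hK.is_nonempty
  let st : ℕ → State K := fun n =>
    Nat.rec ⟨⟨N₀, hN₀⟩, fun _ => spans N₀ hN₀⟩ (fun n x => next n x) n
  let G : ℕ → Bundled.{w} L.Structure := fun n => (st n).1.1
  let f : ∀ n, G n ↪[L] G (n + 1) := fun n =>
    map (st n).1 ((st n).2 n.unpair.1 n.unpair.2)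
  have hst0 : ∀ i k, (st i).2 i k = spans (G i) (st i).1.2 k := by
    intro i k
    cases i with
    | zero => rfl
    | succ i => exact if_neg (by omega)
  have hst : ∀ i k j (hij : i ≤ j), (st j).2 i k =
      (spans (G i) (st i).1.2 k).push
        (DirectedSystem.natLERec (G' := fun n => G n) f i j hij) := by
    intro i k j hij
    induction j, hij using Nat.le_induction with
    | base =>
      rw [hst0]
      simp only [DirectedSystem.natLERec, Nat.leRecOn_self]
      rfl
    | succ j hij ih =>
      have : (st (j + 1)).2 i k = ((st j).2 i k).push (f j) := if_pos hij
      rw [this, ih]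
      simp only [DirectedSystem.natLERec, Nat.leRecOn_succ hij]
      rfl
  refine ⟨G, fun n => (st n).1.2, f, ?_⟩
  intro i S hS T hT e
  obtain ⟨k, hk⟩ := hspans (G i) (st i).1.2 S hS T hT e
  -- The problem is solved no earlier than it is born.
  have hle : i ≤ Nat.pair i k := Nat.left_le_pair i k
  refine ⟨Nat.pair i k + 1, by omega, ?_⟩
  refine hk _ _ ?_
  have key := hmap (st (Nat.pair i k)).1
    ((st (Nat.pair i k)).2 (Nat.pair i k).unpair.1 (Nat.pair i k).unpair.2)
  have h2 : (st (Nat.pair i k)).2 (Nat.pair i k).unpair.1 (Nat.pair i k).unpair.2 = 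
      (spans (G i) (st i).1.2 k).push
        (DirectedSystem.natLERec (G' := fun n => G n) f i _ hle) := by
    rw [Nat.unpair_pair]
    exact hst i k _ hle
  have key' : ((st (Nat.pair i k)).2 (Nat.pair i k).unpair.1 (Nat.pair i k).unpair.2).Solved
      (f (Nat.pair i k)) := key
  rw [h2] at key'
  obtain ⟨g, hg⟩ := key'
  refine ⟨g, ?_⟩
  simp only [DirectedSystem.natLERec, Nat.leRecOn_succ hle]
  exact hg

/-- The image of a finitely generated structure is generated by finitely many elements, which all
come from one stage of the directed system. -/
theorem exists_factor {ι : Type*} [Preorder ι] [IsDirectedOrder ι] [Nonempty ι]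
    {G : ι → Type w} [∀ i, L.Structure (G i)] (f : ∀ i j, i ≤ j → G i ↪[L] G j)
    [DirectedSystem G fun i j h => f i j h] (S : Type*) [L.Structure S]
    (hS : Structure.FG L S) (e : S ↪[L] Language.DirectLimit G f) :
    ∃ (i : ι) (u : S ↪[L] G i), e = (DirectLimit.of L ι G f i).comp u := by
  obtain ⟨i, T, hT⟩ := DirectLimit.exists_fg_substructure_in_Sigma e.toHom.range (hS.range _)
  have hle : ∀ x, e x ∈ (DirectLimit.of L ι G f i).toHom.range := by
    intro x
    have : e x ∈ e.toHom.range := ⟨x, rfl⟩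
    rw [← hT] at this
    obtain ⟨y, -, hy⟩ := this
    exact ⟨y, hy⟩
  refine ⟨i, (DirectLimit.of L ι G f i).equivRange.symm.toEmbedding.comp
    (Embedding.codRestrict _ e hle), ?_⟩
  ext x
  have := congrArg Subtype.val ((DirectLimit.of L ι G f i).equivRange.apply_symm_apply
    ⟨e x, hle x⟩)
  exact this.symm

/-- Fraïssé's theorem: a Fraïssé class has a Fraïssé limit. -/
theorem exists_isFraisseLimit [Countable (Σ l, L.Functions l)] (hK : IsFraisse K) :
    ∃ (M : Bundled.{w} L.Structure) (_ : Countable M), IsFraisseLimit K M := by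
  obtain ⟨G, hG, f, hf⟩ := exists_chain hK
  let F := fun i j hij => DirectedSystem.natLERec (G' := fun n => G n) f i j hij
  let M := Language.DirectLimit (L := L) (fun n => G n) F
  have hcg : Structure.CG L M := DirectLimit.cg _ fun n => (hK.FG _ (hG n)).cg
  have hcount : Countable M := Structure.cg_iff_countable.1 hcg
  have hext : ∀ (i : ℕ) (S : L.Substructure (G i)), S.FG → ∀ T ∈ K, ∀ e : S ↪[L] T,
      ∃ g : T ↪[L] M, g.comp e = (DirectLimit.of L ℕ (fun n => G n) F i).comp S.subtype := by
    intro i S hS T hT e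
    obtain ⟨j, hij, g, hg⟩ := hf i S hS T hT e
    refine ⟨(DirectLimit.of L ℕ (fun n => G n) F j).comp g, ?_⟩
    rw [Embedding.comp_assoc, hg]
    ext x
    exact DirectLimit.of_f (G := fun n => G n) (f := F) (hij := hij)
  have hage : L.age M = K := by
    refine Set.Subset.antisymm ?_ ?_
    · rintro N ⟨hN, ⟨e⟩⟩
      obtain ⟨i, u, -⟩ := exists_factor F N hN e
      exact hK.hereditary _ (hG i) ⟨hN, ⟨u⟩⟩
    · intro T hT
      obtain ⟨P, hP, ⟨p⟩, ⟨q⟩⟩ := hK.jointEmbedding (G 0) (hG 0) T hT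
      obtain ⟨g, -⟩ := hext 0 ⊤ (Structure.fg_def.1 (hK.FG _ (hG 0))) P hP
        (p.comp (Substructure.subtype _))
      exact ⟨hK.FG T hT, ⟨g.comp q⟩⟩
  refine ⟨Bundled.of M, hcount, @IsFraisseLimit.mk _ _ _ _ _ hcount (
    (isUltrahomogeneous_iff_IsExtensionPair hcg).2 ?_) hage⟩
  rw [isExtensionPair_iff_exists_embedding_closure_singleton_sup]
  intro S hS e m
  obtain ⟨i, u, rfl⟩ := exists_factor F S ((Substructure.fg_iff_structure_fg _).1 hS) e
  -- One-point extensions inside M are finitely generated, hence in the age, hence in K, so they are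
  -- among the problems solved by the chain.
  have hT : (⟨(Substructure.closure L {m} ⊔ S : L.Substructure M), inferInstance⟩ :
      Bundled.{w} L.Structure) ∈ K := by
    rw [← hage]
    exact age.fg_substructure ((Substructure.fg_closure_singleton m).sup hS)
  obtain ⟨g, hg⟩ := hext i u.toHom.range
    (Structure.FG.range ((Substructure.fg_iff_structure_fg _).1 hS) _) _ hT
    ((Substructure.inclusion le_sup_right).comp u.equivRange.symm.toEmbedding)
  refine ⟨g, ?_⟩
  ext x
  have := DFunLike.congr_fun hg (u.equivRange x)
  simp only [Embedding.comp_apply,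
    Substructure.coe_subtype, Embedding.equivRange_apply] at this ⊢
  have h2 : u.equivRange.symm.toEmbedding (u.equivRange x) = x :=
    u.equivRange.symm_apply_apply x
  rw [h2] at this
  exact this.symm

end FraisseConstruction

namespace OrdOp

/-! ### Embeddings and generated substructures in the language of ordered sets with operations -/

section Maps

variable {F : Type} {A B : Type} [(lang F).Structure A] [(lang F).Structure B]

theorem le_map (e : A ↪[lang F] B) (a b : A) : le (F := F) B (e a) (e b) ↔ le (F := F) A a b := by
  have := e.map_rel (leSymb : (lang F).Relations 2) ![a, b]
  unfold le
  rw [← this]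
  have h : e ∘ ![a, b] = ![e a, e b] := by
    ext j
    fin_cases j <;> rfl
  rw [h]

theorem op_map (e : A ↪[lang F] B) (i : F) (a : A) : e (op A i a) = op B i (e a) := by
  have := e.map_fun (opSymb i) ![a]
  unfold op
  rw [this]
  congr 1
  ext j
  fin_cases j
  rfl

theorem funMap_eq_op (i : F) (v : Fin 1 → A) :
    Structure.funMap (L := lang F) (OpFun.op i : (lang F).Functions 1) v = op A i (v 0) := by
  unfold op
  congr 1
  ext j
  fin_cases j
  rfl

theorem relMap_iff_le (v : Fin 2 → A) :
    Structure.RelMap (L := lang F) (orderRel.le : (lang F).Relations 2) v ↔ le (F := F) A (v 0) (v 1) := by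
  unfold le
  have : v = ![v 0, v 1] := by
    ext j
    fin_cases j <;> rfl
  rw [← this]
  rfl

/-- An injective map which preserves and reflects the order and commutes with the operations is an
embedding. -/
def mkEmbedding (f : A → B) (hf : Function.Injective f)
    (hop : ∀ (i : F) a, f (op A i a) = op B i (f a))
    (hle : ∀ a b, le (F := F) B (f a) (f b) ↔ le (F := F) A a b) : A ↪[lang F] B where
  toFun := f
  inj' := hf
  map_fun' := by
    rintro _ ⟨i⟩ x
    exact (congrArg f (funMap_eq_op i x)).trans
      ((hop i _).trans (funMap_eq_op i (f ∘ x)).symm)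
  map_rel' := by
    rintro _ ⟨⟩ x
    exact (relMap_iff_le (F := F) (f ∘ x)).trans ((hle _ _).trans (relMap_iff_le (F := F) x).symm)

theorem op_mem (S : (lang F).Substructure A) (i : F) {a : A} (ha : a ∈ S) : op A i a ∈ S := by
  refine S.fun_mem (opSymb i) ![a] ?_
  intro j
  fin_cases j
  exact ha

instance : IsEmpty (lang F).Constants := ⟨fun c => nomatch c⟩

instance : IsEmpty ((lang F).Relations 0) := ⟨fun c => nomatch c⟩

/-- The substructure on a set closed under the operations. -/
def mkSubstructure (S : Set A) (hS : ∀ i : F, ∀ a ∈ S, op A i a ∈ S) : (lang F).Substructure A where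
  carrier := S
  fun_mem := by
    rintro _ ⟨i⟩ x hx
    have := hS i _ (hx 0)
    rwa [← funMap_eq_op] at this

end Maps

section Closure

variable {A B : Type} [(lang Unit).Structure A] [(lang Unit).Structure B]

theorem mem_closure_range {ι : Type*} (v : ι → A) (x : A) :
    x ∈ Substructure.closure (lang Unit) (Set.range v) ↔
      ∃ (j : ι) (i : ℕ), (op A ())^[i] (v j) = x := by
  constructor
  · intro hx
    let S : (lang Unit).Substructure A :=
      mkSubstructure {x | ∃ (j : ι) (i : ℕ), (op A ())^[i] (v j) = x} (by
        rintro ⟨⟩ _ ⟨j, i, rfl⟩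
        exact ⟨j, i + 1, Function.iterate_succ_apply' _ _ _⟩)
    have : Substructure.closure (lang Unit) (Set.range v) ≤ S := by
      rw [Substructure.closure_le]
      rintro _ ⟨j, rfl⟩
      exact ⟨j, 0, rfl⟩
    exact this hx
  · rintro ⟨j, i, rfl⟩
    induction i with
    | zero => exact Substructure.subset_closure ⟨j, rfl⟩
    | succ i ih =>
      rw [Function.iterate_succ_apply']
      exact op_mem _ _ ih

theorem op_iterate_map (e : A ↪[lang Unit] B) (i : ℕ) (a : A) :
    e ((op A ())^[i] a) = (op B ())^[i] (e a) := by
  induction i with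
  | zero => rfl
  | succ i ih => rw [Function.iterate_succ_apply', Function.iterate_succ_apply', op_map, ih]

end Closure

/-! ### Universal classes -/

section Classes

variable {L : FirstOrder.Language.{0, 0}}

/-- Properties of structures which are inherited by substructures and which hold as soon as they
hold in all finitely generated substructures. -/
structure IsLocal (K : StrClass L) : Prop where
  of_embedding : ∀ A B : Bundled.{0} L.Structure, B ∈ K → (A ↪[L] B) → A ∈ K
  of_fg : ∀ M : Bundled.{0} L.Structure,
    (∀ S : L.Substructure M, S.FG → (⟨S, inferInstance⟩ : Bundled.{0} L.Structure) ∈ K) → M ∈ K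

/-- A statement about a triple can be tested in the substructure the triple generates. Three
variables are what transitivity needs. -/
theorem isLocal_forall (P : ∀ A : Bundled.{0} L.Structure, (Fin 3 → A) → Prop)
    (hP : ∀ (A B : Bundled.{0} L.Structure) (e : A ↪[L] B) (v : Fin 3 → A),
      P B (e ∘ v) ↔ P A v) : IsLocal {A | ∀ v, P A v} where
  of_embedding A B hB e v := (hP A B e v).1 (hB _)
  of_fg M hM v := by
    let S := Substructure.closure L (Set.range v)
    have := hM S (Substructure.fg_closure (Set.finite_range v))
      (fun i => ⟨v i, Substructure.subset_closure ⟨i, rfl⟩⟩)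
    exact (hP ⟨S, inferInstance⟩ M S.subtype _).2 this

theorem IsLocal.inter {K K' : StrClass L} (h : IsLocal K) (h' : IsLocal K') :
    IsLocal (K ∩ K') where
  of_embedding A B hB e := ⟨h.of_embedding A B hB.1 e, h'.of_embedding A B hB.2 e⟩
  of_fg M hM := ⟨h.of_fg M fun S hS => (hM S hS).1, h'.of_fg M fun S hS => (hM S hS).2⟩

theorem isLocal_iInter {ι : Sort*} {K : ι → StrClass L} (h : ∀ i, IsLocal (K i)) :
    IsLocal (⋂ i, K i) where
  of_embedding A B hB e := by
    rw [Set.mem_iInter] at *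
    exact fun i => (h i).of_embedding A B (hB i) e
  of_fg M hM := by
    rw [Set.mem_iInter]
    exact fun i => (h i).of_fg M fun S hS => Set.mem_iInter.1 (hM S hS) i

theorem realize_oneUniversal {ψ : L.BoundedFormula Empty 1} (A : Type) [L.Structure A] :
    A ⊨ (ψ.all : L.Sentence) ↔ ∀ a : A, ψ.Realize (default : Empty → A) (fun _ => a) := by
  unfold Sentence.Realize Formula.Realize
  rw [BoundedFormula.realize_all]
  refine forall_congr' fun a => ?_
  have : (Fin.snoc (default : Fin 0 → A) a : Fin 1 → A) = fun _ => a := by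
    ext j
    have hj : j = Fin.last 0 := Subsingleton.elim (α := Fin 1) j (Fin.last 0)
    rw [hj, Fin.snoc_last]
  rw [this]

theorem realize_embedding_one {ψ : L.BoundedFormula Empty 1} (hψ : ψ.IsQF) {A B : Type}
    [L.Structure A] [L.Structure B] (e : A ↪[L] B) (a : A) :
    ψ.Realize (default : Empty → B) (fun _ => e a) ↔
      ψ.Realize (default : Empty → A) (fun _ => a) := by
  rw [← hψ.realize_embedding e, Subsingleton.elim (e ∘ default) default]
  rfl

theorem isLocal_withCond {K : StrClass L} (hK : IsLocal K) {H : Set L.Sentence}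
    (hH : ∀ φ ∈ H, IsOneUniversal φ) : IsLocal (withCond K H) := by
  have : withCond K H = K ∩ ⋂ φ ∈ H, {A : Bundled.{0} L.Structure | A ⊨ φ} := by
    ext A
    simp [withCond]
  rw [this]
  refine hK.inter (isLocal_iInter fun φ => isLocal_iInter fun hφ => ?_)
  obtain ⟨ψ, hψ, rfl⟩ := hH φ hφ
  have : {A : Bundled.{0} L.Structure | A ⊨ (ψ.all : L.Sentence)} =
      {A : Bundled.{0} L.Structure | ∀ v : Fin 3 → A, ψ.Realize (default : Empty → A) (fun _ => v 0)} := by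
    ext A
    simp only [Set.mem_ofPred_eq, realize_oneUniversal]
    exact ⟨fun h v => h _, fun h a => h (fun _ => a)⟩
  rw [this]
  exact isLocal_forall _ fun A B e v => realize_embedding_one hψ e (v 0)

/-- A structure which is the union of two substructures satisfies the one-variable universal
sentences satisfied by both. -/
theorem realize_of_cover {φ : L.Sentence} (hφ : IsOneUniversal φ) {B C D : Type}
    [L.Structure B] [L.Structure C] [L.Structure D] (p : B ↪[L] D) (q : C ↪[L] D)
    (hpq : ∀ d, (∃ b, p b = d) ∨ ∃ c, q c = d) (hB : B ⊨ φ) (hC : C ⊨ φ) : D ⊨ φ := by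
  obtain ⟨ψ, hψ, rfl⟩ := hφ
  rw [realize_oneUniversal] at *
  intro d
  rcases hpq d with ⟨b, rfl⟩ | ⟨c, rfl⟩
  · exact (realize_embedding_one hψ p b).2 (hB b)
  · exact (realize_embedding_one hψ q c).2 (hC c)

variable {F : Type}

theorem lt_map {A B : Type} [(lang F).Structure A] [(lang F).Structure B] (e : A ↪[lang F] B)
    (a b : A) : lt (F := F) B (e a) (e b) ↔ lt (F := F) A a b := by
  unfold lt
  rw [le_map, e.injective.ne_iff]

theorem isPartialOrder_iff {A : Type} {r : A → A → Prop} :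
    IsPartialOrder A r ↔ (∀ a, r a a) ∧ (∀ a b c, r a b → r b c → r a c) ∧
      ∀ a b, r a b → r b a → a = b :=
  ⟨fun h => ⟨h.refl, h.trans, h.antisymm⟩,
    fun h => { refl := h.1, trans := h.2.1, antisymm := h.2.2 }⟩

theorem isLinearOrder_iff {A : Type} {r : A → A → Prop} :
    IsLinearOrder A r ↔ IsPartialOrder A r ∧ ∀ a b, r a b ∨ r b a :=
  ⟨fun h => ⟨h.toIsPartialOrder, h.total⟩,
    fun h => { toIsPartialOrder := h.1, total := h.2 }⟩

theorem isLocal_forall_two (P : ∀ A : Bundled.{0} L.Structure, A → A → Prop)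
    (hP : ∀ (A B : Bundled.{0} L.Structure) (e : A ↪[L] B) (a b : A),
      P B (e a) (e b) ↔ P A a b) : IsLocal {A | ∀ a b, P A a b} := by
  have : {A | ∀ a b, P A a b} = {A : Bundled.{0} L.Structure | ∀ v : Fin 3 → A, P A (v 0) (v 1)} := by
    ext A
    exact ⟨fun h v => h _ _, fun h a b => h ![a, b, b]⟩
  rw [this]
  exact isLocal_forall _ fun A B e v => hP A B e _ _

theorem isLocal_isPartialOrder :
    IsLocal {A : Bundled.{0} (lang F).Structure | IsPartialOrder A (le (F := F) A)} := by
  have : {A : Bundled.{0} (lang F).Structure | IsPartialOrder A (le (F := F) A)} =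
      {A : Bundled.{0} (lang F).Structure | ∀ v : Fin 3 → A, le (F := F) A (v 0) (v 0) ∧
        (le (F := F) A (v 0) (v 1) → le (F := F) A (v 1) (v 2) → le (F := F) A (v 0) (v 2)) ∧
        (le (F := F) A (v 0) (v 1) → le (F := F) A (v 1) (v 0) → v 0 = v 1)} := by
    ext A
    rw [Set.mem_ofPred_eq, isPartialOrder_iff]
    exact ⟨fun h v => ⟨h.1 _, h.2.1 _ _ _, h.2.2 _ _⟩, fun h => ⟨fun a => (h ![a, a, a]).1,
      fun a b c => (h ![a, b, c]).2.1, fun a b => (h ![a, b, b]).2.2⟩⟩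
  rw [this]
  refine isLocal_forall _ fun A B e v => ?_
  simp only [Function.comp_apply, le_map, e.injective.eq_iff]

theorem isLocal_isLinearOrder :
    IsLocal {A : Bundled.{0} (lang F).Structure | IsLinearOrder A (le (F := F) A)} := by
  have : {A : Bundled.{0} (lang F).Structure | IsLinearOrder A (le (F := F) A)} =
      {A : Bundled.{0} (lang F).Structure | IsPartialOrder A (le (F := F) A)} ∩
      {A : Bundled.{0} (lang F).Structure | ∀ a b, le (F := F) A a b ∨ le (F := F) A b a} := by
    ext A
    exact isLinearOrder_iff
  rw [this]
  refine isLocal_isPartialOrder.inter (isLocal_forall_two _ fun A B e a b => ?_)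
  simp only [le_map]

variable (i : F)

theorem isLocal_orderPreserving :
    IsLocal {A : Bundled.{0} (lang F).Structure | OrderPreserving A i} :=
  isLocal_forall_two _ fun A B e a b => by simp only [← op_map, le_map]

theorem isLocal_orderReversing :
    IsLocal {A : Bundled.{0} (lang F).Structure | OrderReversing A i} :=
  isLocal_forall_two _ fun A B e a b => by simp only [← op_map, le_map]

theorem isLocal_strictOrderPreserving :
    IsLocal {A : Bundled.{0} (lang F).Structure | StrictOrderPreserving A i} :=
  isLocal_forall_two _ fun A B e a b => by simp only [← op_map, lt_map]

theorem isLocal_strictOrderReversing :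
    IsLocal {A : Bundled.{0} (lang F).Structure | StrictOrderReversing A i} :=
  isLocal_forall_two _ fun A B e a b => by simp only [← op_map, lt_map]

theorem isLocal_LOp : IsLocal LOp := isLocal_isLinearOrder.inter (isLocal_orderPreserving ())

theorem isLocal_LOsp : IsLocal LOsp :=
  isLocal_isLinearOrder.inter (isLocal_strictOrderPreserving ())

theorem isLocal_LOr : IsLocal LOr := isLocal_isLinearOrder.inter (isLocal_orderReversing ())

theorem isLocal_LOsr : IsLocal LOsr :=
  isLocal_isLinearOrder.inter (isLocal_strictOrderReversing ())

theorem isLocal_PO (F₁ F₂ F₃ F₄ : Set F) : IsLocal (PO F₁ F₂ F₃ F₄) := by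
  have : PO F₁ F₂ F₃ F₄ = {A : Bundled.{0} (lang F).Structure | IsPartialOrder A (le (F := F) A)} ∩
      ((⋂ i ∈ F₁, {A : Bundled.{0} (lang F).Structure | OrderPreserving A i}) ∩ ((⋂ i ∈ F₂, {A : Bundled.{0} (lang F).Structure | OrderReversing A i}) ∩
      ((⋂ i ∈ F₃, {A : Bundled.{0} (lang F).Structure | StrictOrderPreserving A i}) ∩
        (⋂ i ∈ F₄, {A : Bundled.{0} (lang F).Structure | StrictOrderReversing A i})))) := by
    ext A
    simp [PO]
  rw [this]
  exact isLocal_isPartialOrder.inter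
    ((isLocal_iInter fun i => isLocal_iInter fun _ => isLocal_orderPreserving i).inter
    ((isLocal_iInter fun i => isLocal_iInter fun _ => isLocal_orderReversing i).inter
    ((isLocal_iInter fun i => isLocal_iInter fun _ => isLocal_strictOrderPreserving i).inter
    (isLocal_iInter fun i => isLocal_iInter fun _ => isLocal_strictOrderReversing i))))

end Classes

/-! ### Fraïssé limits from amalgamation by unions -/

section Limits

variable {L : FirstOrder.Language.{0, 0}}

/-- Amalgamation in `K` by structures which are the union of the two given ones. -/
def UnionAmalgamation (K : StrClass L) : Prop :=
  ∀ (A B C : Bundled.{0} L.Structure) (i : A ↪[L] B) (j : A ↪[L] C), A ∈ K → B ∈ K → C ∈ K →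
    ∃ D ∈ K, ∃ (p : B ↪[L] D) (q : C ↪[L] D), p.comp i = q.comp j ∧
      ∀ d, (∃ b, p b = d) ∨ ∃ c, q c = d

/-- This is where having only one variable matters: each element of the amalgam comes from B or from
C, so no new instance of a sentence of H has to be checked. -/
theorem UnionAmalgamation.withCond {K : StrClass L} (h : UnionAmalgamation K) {H : Set L.Sentence}
    (hH : ∀ φ ∈ H, IsOneUniversal φ) : UnionAmalgamation (withCond K H) := by
  intro A B C i j hA hB hC
  obtain ⟨D, hD, p, q, hpq, hc⟩ := h A B C i j hA.1 hB.1 hC.1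
  exact ⟨D, ⟨hD, fun φ hφ => realize_of_cover (hH φ hφ) p q hc (hB.2 φ hφ) (hC.2 φ hφ)⟩,
    p, q, hpq, hc⟩

theorem fg_of_cover {B C D : Type} [L.Structure B] [L.Structure C] [L.Structure D]
    (p : B ↪[L] D) (q : C ↪[L] D) (hpq : ∀ d, (∃ b, p b = d) ∨ ∃ c, q c = d)
    (hB : Structure.FG L B) (hC : Structure.FG L C) : Structure.FG L D := by
  have h := (hB.range p.toHom).sup (hC.range q.toHom)
  rw [Structure.fg_def]
  convert h
  refine (eq_top_iff.2 fun d _ => ?_).symm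
  rcases hpq d with ⟨b, rfl⟩ | ⟨c, rfl⟩
  · exact (le_sup_left : _ ≤ p.toHom.range ⊔ q.toHom.range) ⟨b, rfl⟩
  · exact (le_sup_right : _ ≤ p.toHom.range ⊔ q.toHom.range) ⟨c, rfl⟩

theorem finite_of_cover {B C D : Type} (p : B → D) (q : C → D)
    (hpq : ∀ d, (∃ b, p b = d) ∨ ∃ c, q c = d) [Finite B] [Finite C] : Finite D :=
  Finite.of_surjective (Sum.elim p q) fun d =>
    (hpq d).elim (fun ⟨b, h⟩ => ⟨Sum.inl b, h⟩) fun ⟨c, h⟩ => ⟨Sum.inr c, h⟩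

/-- The criterion for the existence of a Fraïssé limit. Here `P` is one of the smallness conditions
"finite" and "finitely generated". -/
theorem exists_limit [Countable (Σ l, L.Functions l)] [IsEmpty L.Constants]
    [IsEmpty (L.Relations 0)] {K : StrClass L}
    (hK : IsLocal K) (hU : UnionAmalgamation K) (P : StrClass L)
    (hfg : ∀ A ∈ P, Structure.FG L A)
    (hsub : ∀ A B : Bundled.{0} L.Structure, B ∈ P → (A ↪[L] B) → Structure.FG L A → A ∈ P)
    (hunion : ∀ (B C D : Bundled.{0} L.Structure) (p : B ↪[L] D) (q : C ↪[L] D),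
      (∀ d, (∃ b, p b = d) ∨ ∃ c, q c = d) → B ∈ P → C ∈ P → D ∈ P)
    (hc : (Quotient.mk' '' (K ∩ P)).Countable) (hne : (K ∩ P).Nonempty) :
    ∃ M ∈ K, ∃ _ : Countable M, IsFraisseLimit (K ∩ P) M := by
  have hAP : Amalgamation (K ∩ P) := by
    intro A B C i j hA hB hC
    obtain ⟨D, hD, p, q, hpq, hcov⟩ := hU A B C i j hA.1 hB.1 hC.1
    exact ⟨D, p, q, ⟨hD, hunion B C D p q hcov hB.2 hC.2⟩, hpq⟩
  have hher : Hereditary (K ∩ P) := by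
    rintro B ⟨hB, hB'⟩ A ⟨hA, ⟨e⟩⟩
    exact ⟨hK.of_embedding A B hB e, hsub A B hB' e hA⟩
  have hF : IsFraisse (K ∩ P) := by
    refine ⟨hne, fun A hA => hfg A hA.2, hc, hher, ?_, hAP⟩
    intro B hB C hC
    -- Joint embedding is amalgamation over the empty substructure, which embeds anywhere since
    -- there are neither constants nor nullary relations.
    let A : Bundled.{0} L.Structure := ⟨(⊥ : L.Substructure B), inferInstance⟩
    have hA : A ∈ K ∩ P := hher B hB (age.fg_substructure Substructure.fg_bot)
    have hbot : IsEmpty (⊥ : L.Substructure B) := inferInstance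
    let j : A ↪[L] C :=
      { toFun := fun x => hbot.elim x
        inj' := fun x => hbot.elim x
        map_fun' := fun f x => hbot.elim (Structure.funMap f x : (⊥ : L.Substructure B))
        map_rel' := by
          intro n r x
          cases n with
          | zero => exact isEmptyElim r
          | succ n => exact hbot.elim (x 0) }
    obtain ⟨D, p, q, hD, -⟩ := hAP A B C (Substructure.subtype _) j hA hB hC
    exact ⟨D, hD, ⟨p⟩, ⟨q⟩⟩
  obtain ⟨M, hM, hlim⟩ := FraisseConstruction.exists_isFraisseLimit hF
  refine ⟨M, hK.of_fg M fun S hS => ?_, hM, hlim⟩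
  have := age.fg_substructure hS
  rw [hlim.age] at this
  exact this.1

theorem exists_limit_fg [Countable (Σ l, L.Functions l)] [IsEmpty L.Constants]
    [IsEmpty (L.Relations 0)] {K : StrClass L}
    (hK : IsLocal K) (hU : UnionAmalgamation K) (hc : (Quotient.mk' '' (fgPart K)).Countable)
    (hne : K.Nonempty) : ∃ M ∈ K, ∃ _ : Countable M, IsFraisseLimit (fgPart K) M := by
  refine exists_limit hK hU {A | Structure.FG L A} (fun A hA => hA) (fun A B _ _ hA => hA)
    (fun B C D p q h hB hC => fg_of_cover p q h hB hC) hc ?_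
  obtain ⟨B, hB⟩ := hne
  have := (Substructure.fg_iff_structure_fg _).1 (Substructure.fg_bot (L := L) (M := B))
  exact ⟨⟨(⊥ : L.Substructure B), inferInstance⟩,
    hK.of_embedding _ B hB (Substructure.subtype _), this⟩

theorem exists_limit_fin [Countable (Σ l, L.Functions l)] [IsEmpty L.Constants]
    [IsEmpty (L.Relations 0)] {K : StrClass L}
    (hK : IsLocal K) (hU : UnionAmalgamation K) (hc : (Quotient.mk' '' (finPart K)).Countable)
    (hne : (finPart K).Nonempty) : ∃ M ∈ K, ∃ _ : Countable M, IsFraisseLimit (finPart K) M := by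
  refine exists_limit hK hU {A | Finite A} (fun A hA => ?_)
    (fun A B hB e _ => ?_)
    (fun B C D p q h hB hC => ?_) hc hne
  · have : Finite A := hA
    exact Structure.FG.of_finite
  · have : Finite B := hB
    exact Finite.of_injective e e.injective
  · have : Finite B := hB
    have : Finite C := hC
    exact finite_of_cover p q h

end Limits

/-! ### Quotients of disjoint unions by preorders -/

section Gluing

variable {F : Type}

/-- The operations on a disjoint union. -/
def sumOp (B C : Type) [(lang F).Structure B] [(lang F).Structure C] (i : F) : B ⊕ C → B ⊕ C :=
  Sum.map (op B i) (op C i)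

/-- `D` is the quotient of the disjoint union of `B` and `C` by a preorder `R`. -/
structure IsGluing {B C D : Type} [(lang F).Structure B] [(lang F).Structure C]
    [(lang F).Structure D] (R : B ⊕ C → B ⊕ C → Prop) (π : B ⊕ C → D) : Prop where
  surjective : Function.Surjective π
  le_iff : ∀ x y, le (F := F) D (π x) (π y) ↔ R x y
  eq_iff : ∀ x y, π x = π y ↔ R x y ∧ R y x
  op_eq : ∀ (i : F) x, op D i (π x) = π (sumOp B C i x)

theorem exists_isGluing {B C : Type} [(lang F).Structure B] [(lang F).Structure C]
    (R : B ⊕ C → B ⊕ C → Prop) (hrefl : ∀ x, R x x) (htrans : ∀ x y z, R x y → R y z → R x z)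
    (hop : ∀ (i : F) x y, R x y → R y x → R (sumOp B C i x) (sumOp B C i y)) :
    ∃ (D : Bundled.{0} (lang F).Structure) (π : B ⊕ C → D), IsGluing (F := F) R π := by
  let s : Setoid (B ⊕ C) :=
    { r := fun x y => R x y ∧ R y x
      iseqv := ⟨fun x => ⟨hrefl x, hrefl x⟩, fun h => ⟨h.2, h.1⟩,
        fun h h' => ⟨htrans _ _ _ h.1 h'.1, htrans _ _ _ h'.2 h.2⟩⟩ }
  let D := Quotient s
  let opD : F → D → D := fun i => Quotient.map (sumOp B C i)
    fun x y h => ⟨hop i x y h.1 h.2, hop i y x h.2 h.1⟩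
  let leD : D → D → Prop := Quotient.lift₂ R fun x y x' y' h h' => propext
    ⟨fun k => htrans _ _ _ h.2 (htrans _ _ _ k h'.1),
      fun k => htrans _ _ _ h.1 (htrans _ _ _ k h'.2)⟩
  let str : (lang F).Structure D :=
    { funMap := fun f v => match f with
        | OpFun.op i => opD i (v 0)
      RelMap := fun r v => match r with
        | orderRel.le => leD (v 0) (v 1) }
  refine ⟨⟨D, str⟩, Quotient.mk s, Quotient.mk_surjective, fun x y => Iff.rfl,
    fun x y => ?_, fun i x => rfl⟩
  exact Quotient.eq

namespace IsGluing

variable {B C D : Type} [(lang F).Structure B] [(lang F).Structure C]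
    [(lang F).Structure D] {R : B ⊕ C → B ⊕ C → Prop} {π : B ⊕ C → D}

theorem lt_iff (h : IsGluing (F := F) R π) (x y : B ⊕ C) :
    lt (F := F) D (π x) (π y) ↔ R x y ∧ ¬ R y x := by
  unfold lt
  rw [h.le_iff, Ne, h.eq_iff]
  tauto

theorem isPartialOrder (h : IsGluing (F := F) R π) (hrefl : ∀ x, R x x)
    (htrans : ∀ x y z, R x y → R y z → R x z) : IsPartialOrder D (le (F := F) D) := by
  rw [isPartialOrder_iff]
  simp only [h.surjective.forall, h.le_iff, h.eq_iff]
  exact ⟨hrefl, htrans, fun _ _ h h' => ⟨h, h'⟩⟩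

theorem isLinearOrder (h : IsGluing (F := F) R π)
    (htrans : ∀ x y z, R x y → R y z → R x z) (htot : ∀ x y, R x y ∨ R y x) :
    IsLinearOrder D (le (F := F) D) := by
  rw [isLinearOrder_iff]
  refine ⟨h.isPartialOrder (fun x => or_self_iff.1 (htot x x)) htrans, ?_⟩
  simpa only [h.surjective.forall, h.le_iff] using htot

theorem orderPreserving (h : IsGluing (F := F) R π) (i : F)
    (hR : ∀ x y, R x y → R (sumOp B C i x) (sumOp B C i y)) : OrderPreserving D i := by
  unfold OrderPreserving
  simpa only [h.surjective.forall, h.op_eq, h.le_iff] using hR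

theorem orderReversing (h : IsGluing (F := F) R π) (i : F)
    (hR : ∀ x y, R x y → R (sumOp B C i y) (sumOp B C i x)) : OrderReversing D i := by
  unfold OrderReversing
  simpa only [h.surjective.forall, h.op_eq, h.le_iff] using hR

theorem strictOrderPreserving (h : IsGluing (F := F) R π) (i : F)
    (hR : ∀ x y, R x y → ¬ R y x →
      R (sumOp B C i x) (sumOp B C i y) ∧ ¬ R (sumOp B C i y) (sumOp B C i x)) :
    StrictOrderPreserving D i := by
  unfold StrictOrderPreserving
  simpa only [h.surjective.forall, h.op_eq, h.lt_iff, and_imp] using hR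

theorem strictOrderReversing (h : IsGluing (F := F) R π) (i : F)
    (hR : ∀ x y, R x y → ¬ R y x →
      R (sumOp B C i y) (sumOp B C i x) ∧ ¬ R (sumOp B C i x) (sumOp B C i y)) :
    StrictOrderReversing D i := by
  unfold StrictOrderReversing
  simpa only [h.surjective.forall, h.op_eq, h.lt_iff, and_imp] using hR

end IsGluing

/-- Amalgamation from a preorder on the disjoint union. -/
theorem exists_amalgam {K : StrClass (lang F)} (A B C : Bundled.{0} (lang F).Structure)
    (i : A ↪[lang F] B) (j : A ↪[lang F] C) [IsPartialOrder B (le (F := F) B)]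
    [IsPartialOrder C (le (F := F) C)] (R : B ⊕ C → B ⊕ C → Prop) (hrefl : ∀ x, R x x)
    (htrans : ∀ x y z, R x y → R y z → R x z)
    (hop : ∀ (i : F) x y, R x y → R y x → R (sumOp B C i x) (sumOp B C i y))
    (hB : ∀ b b', R (.inl b) (.inl b') ↔ le (F := F) B b b')
    (hC : ∀ c c', R (.inr c) (.inr c') ↔ le (F := F) C c c')
    (hA : ∀ a, R (.inl (i a)) (.inr (j a)) ∧ R (.inr (j a)) (.inl (i a)))
    (hK : ∀ (D : Bundled.{0} (lang F).Structure) (π : B ⊕ C → D), IsGluing (F := F) R π → D ∈ K) :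
    ∃ D ∈ K, ∃ (p : B ↪[lang F] D) (q : C ↪[lang F] D), p.comp i = q.comp j ∧
      ∀ d, (∃ b, p b = d) ∨ ∃ c, q c = d := by
  obtain ⟨D, π, h⟩ := exists_isGluing R hrefl htrans hop
  refine ⟨D, hK D π h, mkEmbedding (fun b => π (.inl b)) ?_ ?_ ?_,
    mkEmbedding (fun c => π (.inr c)) ?_ ?_ ?_, ?_, ?_⟩
  · intro b b' e
    have e' := (h.eq_iff _ _).1 e
    rw [hB, hB] at e'
    exact antisymm e'.1 e'.2
  · exact fun i a => (h.op_eq i (.inl a)).symm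
  · exact fun b b' => (h.le_iff _ _).trans (hB b b')
  · intro b b' e
    have e' := (h.eq_iff _ _).1 e
    rw [hC, hC] at e'
    exact antisymm e'.1 e'.2
  · exact fun i a => (h.op_eq i (.inr a)).symm
  · exact fun b b' => (h.le_iff _ _).trans (hC b b')
  · ext a
    exact (h.eq_iff _ _).2 (hA a)
  · intro d
    obtain ⟨b | c, rfl⟩ := h.surjective d
    · exact Or.inl ⟨b, rfl⟩
    · exact Or.inr ⟨c, rfl⟩

end Gluing

/-! ### Amalgamation of posets with operations -/

section Posets

variable {F : Type} {A B C : Type} [(lang F).Structure A] [(lang F).Structure B]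
  [(lang F).Structure C]

/-- The least order on the disjoint union of `B` and `C` which identifies the two copies of `A`. -/
def unionLe (i : A → B) (j : A → C) : B ⊕ C → B ⊕ C → Prop
  | .inl b, .inl b' => le (F := F) B b b'
  | .inr c, .inr c' => le (F := F) C c c'
  | .inl b, .inr c => ∃ a, le (F := F) B b (i a) ∧ le (F := F) C (j a) c
  | .inr c, .inl b => ∃ a, le (F := F) C c (j a) ∧ le (F := F) B (i a) b

variable (i : A ↪[lang F] B) (j : A ↪[lang F] C)

theorem unionLe_refl [IsPartialOrder B (le (F := F) B)] [IsPartialOrder C (le (F := F) C)] :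
    ∀ x, unionLe (F := F) i j x x
  | .inl b => refl_of (le (F := F) B) b
  | .inr c => refl_of (le (F := F) C) c

theorem unionLe_trans [IsPartialOrder B (le (F := F) B)] [IsPartialOrder C (le (F := F) C)] :
    ∀ x y z, unionLe (F := F) i j x y → unionLe (F := F) i j y z → unionLe (F := F) i j x z := by
  have tB : ∀ {x y z}, le (F := F) B x y → le (F := F) B y z → le (F := F) B x z :=
    fun h h' => trans_of (le (F := F) B) h h'
  have tC : ∀ {x y z}, le (F := F) C x y → le (F := F) C y z → le (F := F) C x z :=
    fun h h' => trans_of (le (F := F) C) h h'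
  have hBC : ∀ {a a'}, le (F := F) B (i a) (i a') → le (F := F) C (j a) (j a') :=
    fun h => (le_map j _ _).2 ((le_map i _ _).1 h)
  have hCB : ∀ {a a'}, le (F := F) C (j a) (j a') → le (F := F) B (i a) (i a') :=
    fun h => (le_map i _ _).2 ((le_map j _ _).1 h)
  rintro (x | x) (y | y) (z | z) h h'
  · exact tB h h'
  · obtain ⟨a, ha, ha'⟩ := h'
    exact ⟨a, tB h ha, ha'⟩
  · obtain ⟨a, ha, ha'⟩ := h
    obtain ⟨a', hb, hb'⟩ := h'
    exact tB ha (tB (hCB (tC ha' hb)) hb')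
  · obtain ⟨a, ha, ha'⟩ := h
    exact ⟨a, ha, tC ha' h'⟩
  · obtain ⟨a, ha, ha'⟩ := h
    exact ⟨a, ha, tB ha' h'⟩
  · obtain ⟨a, ha, ha'⟩ := h
    obtain ⟨a', hb, hb'⟩ := h'
    exact tC ha (tC (hBC (tB ha' hb)) hb')
  · obtain ⟨a, ha, ha'⟩ := h'
    exact ⟨a, tC h ha, ha'⟩
  · exact tC h h'

theorem unionLe_op_of_preserving {k : F} (hB : OrderPreserving B k) (hC : OrderPreserving C k) :
    ∀ x y, unionLe (F := F) i j x y → unionLe (F := F) i j (sumOp B C k x) (sumOp B C k y) := by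
  rintro (x | x) (y | y) h
  · exact hB _ _ h
  · obtain ⟨a, ha, ha'⟩ := h
    exact ⟨op A k a, by rw [op_map]; exact hB _ _ ha, by rw [op_map]; exact hC _ _ ha'⟩
  · obtain ⟨a, ha, ha'⟩ := h
    exact ⟨op A k a, by rw [op_map]; exact hC _ _ ha, by rw [op_map]; exact hB _ _ ha'⟩
  · exact hC _ _ h

theorem unionLe_op_of_reversing {k : F} (hB : OrderReversing B k) (hC : OrderReversing C k) :
    ∀ x y, unionLe (F := F) i j x y → unionLe (F := F) i j (sumOp B C k y) (sumOp B C k x) := by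
  rintro (x | x) (y | y) h
  · exact hB _ _ h
  · obtain ⟨a, ha, ha'⟩ := h
    exact ⟨op A k a, by rw [op_map]; exact hC _ _ ha', by rw [op_map]; exact hB _ _ ha⟩
  · obtain ⟨a, ha, ha'⟩ := h
    exact ⟨op A k a, by rw [op_map]; exact hB _ _ ha', by rw [op_map]; exact hC _ _ ha⟩
  · exact hC _ _ h

theorem StrictOrderPreserving.orderPreserving [IsPartialOrder B (le (F := F) B)] {k : F}
    (h : StrictOrderPreserving B k) : OrderPreserving B k := by
  intro a b hab
  by_cases hne : a = b
  · subst hne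
    exact refl_of (le (F := F) B) _
  · exact (h a b ⟨hab, hne⟩).1

theorem StrictOrderReversing.orderReversing [IsPartialOrder B (le (F := F) B)] {k : F}
    (h : StrictOrderReversing B k) : OrderReversing B k := by
  intro a b hab
  by_cases hne : a = b
  · subst hne
    exact refl_of (le (F := F) B) _
  · exact (h a b ⟨hab, hne⟩).1

/-- A monotone or antitone map sends the interval from x to z between the images of its ends; if
these are equivalent, so is everything between them. -/
theorem squeeze_op {X : Type} {R : X → X → Prop} {f : X → X}
    (htrans : ∀ x y z, R x y → R y z → R x z)
    (hf : (∀ x y, R x y → R (f x) (f y)) ∨ ∀ x y, R x y → R (f y) (f x)) {x y z : X}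
    (hxy : R x y) (hyz : R y z) (h : R (f x) (f z)) (h' : R (f z) (f x)) :
    (R (f x) (f y) ∧ R (f y) (f x)) ∧ R (f y) (f z) ∧ R (f z) (f y) := by
  rcases hf with hf | hf
  · exact ⟨⟨hf _ _ hxy, htrans _ _ _ (hf _ _ hyz) h'⟩, hf _ _ hyz, htrans _ _ _ h' (hf _ _ hxy)⟩
  · exact ⟨⟨htrans _ _ _ h (hf _ _ hyz), hf _ _ hxy⟩, htrans _ _ _ (hf _ _ hxy) h, hf _ _ hyz⟩

/-- A strict operation does not identify comparable elements of the union. -/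
theorem unionLe_of_op [IsPartialOrder B (le (F := F) B)] [IsPartialOrder C (le (F := F) C)] {k : F}
    (hB : ∀ b b', lt (F := F) B b b' → op B k b ≠ op B k b')
    (hC : ∀ c c', lt (F := F) C c c' → op C k c ≠ op C k c')
    (hf : (∀ x y, unionLe (F := F) i j x y → unionLe (F := F) i j (sumOp B C k x) (sumOp B C k y)) ∨
      ∀ x y, unionLe (F := F) i j x y → unionLe (F := F) i j (sumOp B C k y) (sumOp B C k x))
    (x y : B ⊕ C) (h : unionLe (F := F) i j x y)
    (h₁ : unionLe (F := F) i j (sumOp B C k x) (sumOp B C k y))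
    (h₂ : unionLe (F := F) i j (sumOp B C k y) (sumOp B C k x)) : unionLe (F := F) i j y x := by
  have sq := fun {x y z} => squeeze_op (x := x) (y := y) (z := z) (unionLe_trans (F := F) i j) hf
  have eB : ∀ {b b'}, le (F := F) B b b' →
      unionLe (F := F) i j (sumOp B C k (.inl b)) (sumOp B C k (.inl b')) ∧
      unionLe (F := F) i j (sumOp B C k (.inl b')) (sumOp B C k (.inl b)) → b = b' := by
    intro b b' hb e
    by_contra hne
    exact hB b b' ⟨hb, hne⟩ (antisymm_of (le (F := F) B) e.1 e.2)
  have eC : ∀ {c c'}, le (F := F) C c c' →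
      unionLe (F := F) i j (sumOp B C k (.inr c)) (sumOp B C k (.inr c')) ∧
      unionLe (F := F) i j (sumOp B C k (.inr c')) (sumOp B C k (.inr c)) → c = c' := by
    intro c c' hc e
    by_contra hne
    exact hC c c' ⟨hc, hne⟩ (antisymm_of (le (F := F) C) e.1 e.2)
  have rB : ∀ b, le (F := F) B b b := refl_of (le (F := F) B)
  have rC : ∀ c, le (F := F) C c c := refl_of (le (F := F) C)
  rcases x with x | x <;> rcases y with y | y
  · obtain rfl := eB h ⟨h₁, h₂⟩
    exact h
  · obtain ⟨a, ha, ha'⟩ := h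
    -- The intermediate element a has two copies. The copy in B shows, after squeezing, that the
    -- operation does not separate x from `i a`, so strictness in B gives equality; the copy in C
    -- does the same for y.
    have hx : unionLe (F := F) i j (.inl x) (.inl (i a)) := ha
    have hy : unionLe (F := F) i j (.inl (i a)) (.inr y) := ⟨a, rB _, ha'⟩
    have hx' : unionLe (F := F) i j (.inl x) (.inr (j a)) := ⟨a, ha, rC _⟩
    have hy' : unionLe (F := F) i j (.inr (j a)) (.inr y) := ha'
    obtain rfl := eB ha (sq hx hy h₁ h₂).1
    obtain rfl := eC ha' (sq hx' hy' h₁ h₂).2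
    exact ⟨a, rC _, rB _⟩
  · obtain ⟨a, ha, ha'⟩ := h
    have hx : unionLe (F := F) i j (.inr x) (.inr (j a)) := ha
    have hy : unionLe (F := F) i j (.inr (j a)) (.inl y) := ⟨a, rC _, ha'⟩
    have hx' : unionLe (F := F) i j (.inr x) (.inl (i a)) := ⟨a, ha, rB _⟩
    have hy' : unionLe (F := F) i j (.inl (i a)) (.inl y) := ha'
    obtain rfl := eC ha (sq hx hy h₁ h₂).1
    obtain rfl := eB ha' (sq hx' hy' h₁ h₂).2
    exact ⟨a, rB _, rC _⟩
  · obtain rfl := eC h ⟨h₁, h₂⟩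
    exact h

theorem unionAmalgamation_PO {F₁ F₂ F₃ F₄ : Set F} (hF : F₁ ∪ F₂ ∪ F₃ ∪ F₄ = Set.univ) :
    UnionAmalgamation (PO F₁ F₂ F₃ F₄) := by
  rintro A B C i j - ⟨hB, hB₁, hB₂, hB₃, hB₄⟩ ⟨hC, hC₁, hC₂, hC₃, hC₄⟩
  have mono : ∀ k ∈ F₁ ∪ F₃, ∀ x y, unionLe (F := F) i j x y →
      unionLe (F := F) i j (sumOp B C k x) (sumOp B C k y) := by
    rintro k (hk | hk)
    · exact unionLe_op_of_preserving i j (hB₁ k hk) (hC₁ k hk)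
    · exact unionLe_op_of_preserving i j (hB₃ k hk).orderPreserving (hC₃ k hk).orderPreserving
  have anti : ∀ k ∈ F₂ ∪ F₄, ∀ x y, unionLe (F := F) i j x y →
      unionLe (F := F) i j (sumOp B C k y) (sumOp B C k x) := by
    rintro k (hk | hk)
    · exact unionLe_op_of_reversing i j (hB₂ k hk) (hC₂ k hk)
    · exact unionLe_op_of_reversing i j (hB₄ k hk).orderReversing (hC₄ k hk).orderReversing
  refine exists_amalgam A B C i j (unionLe (F := F) i j) (unionLe_refl i j) (unionLe_trans i j) ?_
    (fun _ _ => Iff.rfl) (fun _ _ => Iff.rfl)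
    (fun a => ⟨⟨a, refl_of (le (F := F) B) _, refl_of (le (F := F) C) _⟩,
      ⟨a, refl_of (le (F := F) C) _, refl_of (le (F := F) B) _⟩⟩) ?_
  -- The operation is well defined on the quotient because every symbol is monotone or antitone for
  -- the preorder.
  · intro k x y h h'
    have hk : k ∈ F₁ ∪ F₂ ∪ F₃ ∪ F₄ := hF ▸ Set.mem_univ k
    rcases hk with ((hk | hk) | hk) | hk
    · exact mono k (.inl hk) x y h
    · exact anti k (.inl hk) y x h'
    · exact mono k (.inr hk) x y h
    · exact anti k (.inr hk) y x h'
  · intro D π h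
    refine ⟨h.isPartialOrder (unionLe_refl i j) (unionLe_trans i j),
      fun k hk => h.orderPreserving k (mono k (.inl hk)),
      fun k hk => h.orderReversing k (anti k (.inl hk)),
      fun k hk => h.strictOrderPreserving k fun x y hxy hyx => ⟨mono k (.inr hk) x y hxy, fun hr =>
        hyx (unionLe_of_op i j (fun b b' hb => (hB₃ k hk b b' hb).2)
          (fun c c' hc => (hC₃ k hk c c' hc).2) (.inl (mono k (.inr hk))) x y hxy
          (mono k (.inr hk) x y hxy) hr)⟩,
      fun k hk => h.strictOrderReversing k fun x y hxy hyx => ⟨anti k (.inr hk) x y hxy, fun hr =>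
        hyx (unionLe_of_op i j (fun b b' hb => (hB₄ k hk b b' hb).2.symm)
          (fun c c' hc => (hC₄ k hk c c' hc).2.symm) (.inr (anti k (.inr hk))) x y hxy
          hr (anti k (.inr hk) x y hxy))⟩⟩

end Posets

set_option linter.unusedSectionVars false

/-! ### Lexicographic comparison of orbits -/

section Keys

variable {X Q : Type} (f : X → X) (q : X → Q) (r : ℕ → Q → Q → Prop)

/-- The orbits of `x` and `y` under `f` have the same image under `q`. -/
def KeyEq (x y : X) : Prop := ∀ n, q (f^[n] x) = q (f^[n] y)

/-- The orbits of `x` and `y` under `f` are compared lexicographically, the terms of index `n`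
through `r n`. -/
def KeyLt (x y : X) : Prop :=
  ∃ n, (∀ m < n, q (f^[m] x) = q (f^[m] y)) ∧ r n (q (f^[n] x)) (q (f^[n] y))

variable {f q r}

theorem KeyEq.refl (x : X) : KeyEq f q x x := fun _ => rfl

theorem KeyEq.symm {x y : X} (h : KeyEq f q x y) : KeyEq f q y x := fun n => (h n).symm

theorem KeyEq.trans {x y z : X} (h : KeyEq f q x y) (h' : KeyEq f q y z) : KeyEq f q x z :=
  fun n => (h n).trans (h' n)

theorem KeyEq.map {x y : X} (h : KeyEq f q x y) : KeyEq f q (f x) (f y) := fun n => h (n + 1)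

theorem KeyEq.of_map {x y : X} (h : KeyEq f q (f x) (f y)) (h₀ : q x = q y) : KeyEq f q x y
  | 0 => h₀
  | n + 1 => h n

theorem KeyLt.trans_eq {x y z : X} (h : KeyLt f q r x y) (h' : KeyEq f q y z) :
    KeyLt f q r x z := by
  obtain ⟨n, hn, hr⟩ := h
  exact ⟨n, fun m hm => (hn m hm).trans (h' m), h' n ▸ hr⟩

theorem KeyEq.trans_lt {x y z : X} (h : KeyEq f q x y) (h' : KeyLt f q r y z) :
    KeyLt f q r x z := by
  obtain ⟨n, hn, hr⟩ := h'
  exact ⟨n, fun m hm => (h m).trans (hn m hm), (h n).symm ▸ hr⟩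

variable [hr : ∀ n, IsStrictTotalOrder Q (r n)]

theorem KeyLt.trans {x y z : X} (h : KeyLt f q r x y) (h' : KeyLt f q r y z) :
    KeyLt f q r x z := by
  obtain ⟨n, hn, hr⟩ := h
  obtain ⟨m, hm, hr'⟩ := h'
  rcases lt_trichotomy n m with hnm | rfl | hnm
  · exact ⟨n, fun k hk => (hn k hk).trans (hm k (hk.trans hnm)), hm n hnm ▸ hr⟩
  · exact ⟨n, fun k hk => (hn k hk).trans (hm k hk), _root_.trans hr hr'⟩
  · exact ⟨m, fun k hk => (hn k (hk.trans hnm)).trans (hm k hk), (hn m hnm).symm ▸ hr'⟩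

theorem KeyLt.not_keyEq {x y : X} (h : KeyLt f q r x y) : ¬ KeyEq f q x y := by
  rintro h'
  obtain ⟨n, hn, hr⟩ := h
  rw [h' n] at hr
  exact irrefl _ hr

theorem KeyLt.asymm {x y : X} (h : KeyLt f q r x y) (h' : KeyLt f q r y x) : False :=
  (h.trans h').not_keyEq (KeyEq.refl x)

theorem key_trichotomy (x y : X) : KeyLt f q r x y ∨ KeyEq f q x y ∨ KeyLt f q r y x := by
  classical
  by_cases h : KeyEq f q x y
  · exact Or.inr (Or.inl h)
  · have h' : ∃ n, q (f^[n] x) ≠ q (f^[n] y) := by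
      simpa [KeyEq] using h
    have hlt : ∀ m < Nat.find h', q (f^[m] x) = q (f^[m] y) := fun m hm =>
      not_not.1 (Nat.find_min h' hm)
    rcases trichotomous_of (r (Nat.find h')) (q (f^[Nat.find h'] x)) (q (f^[Nat.find h'] y)) with
      h₁ | h₁ | h₁
    · exact Or.inl ⟨_, hlt, h₁⟩
    · exact (Nat.find_spec h' h₁).elim
    · exact Or.inr (Or.inr ⟨_, fun m hm => (hlt m hm).symm, h₁⟩)

end Keys

/-! ### Total preorders on a disjoint union, by keys and then by a tie rule -/

section LexGluing

variable {B C Q : Type} [LinearOrder B] [LinearOrder C] (f : B ⊕ C → B ⊕ C)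
  (q : B ⊕ C → Q) (r : ℕ → Q → Q → Prop) (G o : B ⊕ C → Prop)

/-- The comparison of elements with the same key: elements of different sides are identified if
`G` holds, and otherwise `o` tells whether those of `B` come first. -/
def TieLe : B ⊕ C → B ⊕ C → Prop
  | .inl b, .inl b' => b ≤ b'
  | .inr c, .inr c' => c ≤ c'
  | .inl b, .inr _ => G (.inl b) ∨ o (.inl b)
  | .inr c, .inl _ => G (.inr c) ∨ ¬ o (.inr c)

/-- The lexicographic order on the disjoint union: first by keys, then by `TieLe`. -/
def LexLe (x y : B ⊕ C) : Prop := KeyLt f q r x y ∨ KeyEq f q x y ∧ TieLe G o x y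

/-- The hypotheses under which `LexLe` is a total preorder extending the two orders. -/
structure LexHyp : Prop where
  strict : ∀ n, IsStrictTotalOrder Q (r n)
  inv_glued : ∀ x y, KeyEq f q x y → G x → G y
  inv_orient : ∀ x y, KeyEq f q x y → o x → o y
  uniq_left : ∀ b b', G (.inl b) → KeyEq f q (.inl b) (.inl b') → b = b'
  uniq_right : ∀ c c', G (.inr c) → KeyEq f q (.inr c) (.inr c') → c = c'
  mono_left : ∀ b b', b ≤ b' → ¬ KeyLt f q r (.inl b') (.inl b)
  mono_right : ∀ c c', c ≤ c' → ¬ KeyLt f q r (.inr c') (.inr c)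

variable {f q r G o}

namespace LexHyp

variable (h : LexHyp f q r G o)
include h

theorem lexLe_trans (x y z : B ⊕ C) (hxy : LexLe f q r G o x y) (hyz : LexLe f q r G o y z) :
    LexLe f q r G o x z := by
  have := h.strict
  rcases hxy with hxy | ⟨hxy, txy⟩ <;> rcases hyz with hyz | ⟨hyz, tyz⟩
  · exact .inl (hxy.trans hyz)
  · exact .inl (hxy.trans_eq hyz)
  · exact .inl (hxy.trans_lt hyz)
  · refine .inr ⟨hxy.trans hyz, ?_⟩
    have G₁ := h.inv_glued _ _ hxy
    have G₂ := h.inv_glued _ _ hyz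
    have G₃ := h.inv_glued _ _ hxy.symm
    have o₁ := h.inv_orient _ _ hxy
    have o₂ := h.inv_orient _ _ hyz
    have o₃ := h.inv_orient _ _ hxy.symm
    rcases x with x | x <;> rcases y with y | y <;> rcases z with z | z <;>
      simp only [TieLe] at *
    · exact txy.trans tyz
    · tauto
    · have hG : G (.inl x) := by tauto
      exact (h.uniq_left x z hG (hxy.trans hyz)).le
    · tauto
    · tauto
    · have hG : G (.inr x) := by tauto
      exact (h.uniq_right x z hG (hxy.trans hyz)).le
    · tauto
    · exact txy.trans tyz

theorem lexLe_total (x y : B ⊕ C) : LexLe f q r G o x y ∨ LexLe f q r G o y x := by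
  have := h.strict
  rcases key_trichotomy (f := f) (q := q) (r := r) x y with h' | h' | h'
  · exact .inl (.inl h')
  · have ht : TieLe G o x y ∨ TieLe G o y x := by
      have o₁ := h.inv_orient _ _ h'
      have o₃ := h.inv_orient _ _ h'.symm
      rcases x with x | x <;> rcases y with y | y <;> simp only [TieLe]
      · exact le_total x y
      · tauto
      · tauto
      · exact le_total x y
    exact ht.imp (fun t => .inr ⟨h', t⟩) fun t => .inr ⟨h'.symm, t⟩
  · exact .inr (.inl h')

theorem lexLe_inl (b b' : B) : LexLe f q r G o (.inl b) (.inl b') ↔ b ≤ b' := by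
  have := h.strict
  constructor
  · rintro (h' | h')
    · exact (le_total b b').elim id fun hb => (h.mono_left _ _ hb h').elim
    · exact h'.2
  · intro hb
    rcases key_trichotomy (f := f) (q := q) (r := r) (.inl b) (.inl b') with h' | h' | h'
    · exact .inl h'
    · exact .inr ⟨h', hb⟩
    · exact (h.mono_left _ _ hb h').elim

theorem lexLe_inr (c c' : C) : LexLe f q r G o (.inr c) (.inr c') ↔ c ≤ c' := by
  have := h.strict
  constructor
  · rintro (h' | h')
    · exact (le_total c c').elim id fun hb => (h.mono_right _ _ hb h').elim
    · exact h'.2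
  · intro hb
    rcases key_trichotomy (f := f) (q := q) (r := r) (.inr c) (.inr c') with h' | h' | h'
    · exact .inl h'
    · exact .inr ⟨h', hb⟩
    · exact (h.mono_right _ _ hb h').elim

theorem keyEq_of_equiv {x y : B ⊕ C} (h₁ : LexLe f q r G o x y) (h₂ : LexLe f q r G o y x) :
    KeyEq f q x y := by
  have := h.strict
  rcases h₁ with h₁ | h₁
  · rcases h₂ with h₂ | h₂
    · exact (h₁.asymm h₂).elim
    · exact (h₁.not_keyEq h₂.1.symm).elim
  · exact h₁.1

end LexHyp

theorem lexLe_of_glued {x y : B ⊕ C} (hG : G x) (hG' : G y) (h : KeyEq f q x y)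
    (hs : x.isLeft ≠ y.isLeft) : LexLe f q r G o x y := by
  refine .inr ⟨h, ?_⟩
  rcases x with x | x <;> rcases y with y | y
  · exact (hs rfl).elim
  · exact .inl hG
  · exact .inl hG
  · exact (hs rfl).elim

/-- This yields strictness of the operation on the quotient. Equivalent images have equal keys, and
`hq` supplies the missing first entry of the keys of x and y. Equivalent images from different sides
must be glued, since `o` cannot order them both ways, and gluing pulls back along f. -/
theorem LexHyp.lexLe_of_map_equiv (h : LexHyp f q r G o)
    (hq : ∀ x y, LexLe f q r G o (f x) (f y) → LexLe f q r G o (f y) (f x) → q x = q y)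
    (hleft : ∀ b b', f (.inl b) = f (.inl b') → b = b')
    (hright : ∀ c c', f (.inr c) = f (.inr c') → c = c')
    (hside : ∀ x, (f x).isLeft = x.isLeft)
    (hG : ∀ x, G (f x) → G x) (x y : B ⊕ C) (h₁ : LexLe f q r G o (f x) (f y))
    (h₂ : LexLe f q r G o (f y) (f x)) : LexLe f q r G o x y := by
  have hk := (h.keyEq_of_equiv h₁ h₂)
  have hk' := hk.of_map (hq x y h₁ h₂)
  have := h.strict
  have t₁ : TieLe G o (f x) (f y) := by
    rcases h₁ with h₁ | h₁
    · exact (h₁.not_keyEq hk).elim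
    · exact h₁.2
  have t₂ : TieLe G o (f y) (f x) := by
    rcases h₂ with h₂ | h₂
    · exact (h₂.not_keyEq hk.symm).elim
    · exact h₂.2
  refine .inr ⟨hk', ?_⟩
  have G₁ := h.inv_glued _ _ hk
  have G₃ := h.inv_glued _ _ hk.symm
  have o₁ := h.inv_orient _ _ hk
  have o₃ := h.inv_orient _ _ hk.symm
  have Gx := hG x
  have sx := hside x
  have sy := hside y
  rcases x with x | x <;> rcases y with y | y
  · obtain ⟨x', hx⟩ := Sum.isLeft_iff.1 sx
    obtain ⟨y', hy⟩ := Sum.isLeft_iff.1 sy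
    rw [hx, hy] at t₁ t₂
    exact (hleft x y (by rw [hx, hy, le_antisymm t₁ t₂])).le
  · obtain ⟨x', hx⟩ := Sum.isLeft_iff.1 sx
    obtain ⟨y', hy⟩ := Sum.isRight_iff.1 (Sum.isLeft_eq_false.1 sy)
    rw [hx, hy] at t₁ t₂ G₁ G₃ o₁ o₃
    rw [hx] at Gx
    have k₁ := h.inv_orient _ _ hk'
    simp only [TieLe] at t₁ t₂ ⊢
    tauto
  · obtain ⟨x', hx⟩ := Sum.isRight_iff.1 (Sum.isLeft_eq_false.1 sx)
    obtain ⟨y', hy⟩ := Sum.isLeft_iff.1 sy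
    rw [hx, hy] at t₁ t₂ G₁ G₃ o₁ o₃
    rw [hx] at Gx
    have k₁ := h.inv_orient _ _ hk'
    simp only [TieLe] at t₁ t₂ ⊢
    tauto
  · obtain ⟨x', hx⟩ := Sum.isRight_iff.1 (Sum.isLeft_eq_false.1 sx)
    obtain ⟨y', hy⟩ := Sum.isRight_iff.1 (Sum.isLeft_eq_false.1 sy)
    rw [hx, hy] at t₁ t₂
    exact (hright x y (by rw [hx, hy, le_antisymm t₁ t₂])).le

end LexGluing

/-! ### Pulling back the identifications along a strict operation -/

section Glued

variable {B C Q : Type} {fB : B → B} {fC : C → C} {q : B ⊕ C → Q} {G₀ : B ⊕ C → Prop} {st : Prop}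

/-- The closure of `G₀` under preimages, if `st` holds. -/
def GluedClosure (f : B ⊕ C → B ⊕ C) (G₀ : B ⊕ C → Prop) (st : Prop) (x : B ⊕ C) : Prop :=
  G₀ x ∨ st ∧ ∃ n, G₀ (f^[n] x)

theorem KeyEq.iterate {X : Type} {f : X → X} {q : X → Q} {x y : X} (h : KeyEq f q x y) (n : ℕ) :
    KeyEq f q (f^[n] x) (f^[n] y) := by
  intro m
  rw [← Function.iterate_add_apply, ← Function.iterate_add_apply]
  exact h _

theorem sumMap_iterate_inl (n : ℕ) (b : B) :
    (Sum.map fB fC)^[n] (.inl b) = .inl (fB^[n] b) := by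
  induction n with
  | zero => rfl
  | succ n ih => rw [Function.iterate_succ_apply', ih, Function.iterate_succ_apply']; rfl

theorem sumMap_iterate_inr (n : ℕ) (c : C) :
    (Sum.map fB fC)^[n] (.inr c) = .inr (fC^[n] c) := by
  induction n with
  | zero => rfl
  | succ n ih => rw [Function.iterate_succ_apply', ih, Function.iterate_succ_apply']; rfl

theorem GluedClosure.inv {f : B ⊕ C → B ⊕ C} (h : ∀ x y, KeyEq f q x y → G₀ x → G₀ y)
    (x y : B ⊕ C) (hk : KeyEq f q x y) : GluedClosure f G₀ st x → GluedClosure f G₀ st y :=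
  Or.imp (h x y hk) (And.imp_right fun ⟨n, hn⟩ => ⟨n, h _ _ (hk.iterate n) hn⟩)

theorem GluedClosure.map {f : B ⊕ C → B ⊕ C} (h : ∀ x, G₀ x → G₀ (f x)) (x : B ⊕ C) :
    GluedClosure f G₀ st x → GluedClosure f G₀ st (f x) :=
  Or.imp (h x) (And.imp_right fun ⟨n, hn⟩ => ⟨n, by
    rw [← Function.iterate_succ_apply, Function.iterate_succ_apply']
    exact h _ hn⟩)

theorem GluedClosure.of_map {f : B ⊕ C → B ⊕ C} (hst : st) (x : B ⊕ C) :
    GluedClosure f G₀ st (f x) → GluedClosure f G₀ st x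
  | .inl h => .inr ⟨hst, 1, h⟩
  | .inr ⟨_, n, h⟩ => .inr ⟨hst, n + 1, h⟩

/-- The n-th iterates have equal keys and are already unique for `G₀`; injectivity of the operation
brings the equality back. -/
theorem GluedClosure.uniq_left (hst : st → Function.Injective fB)
    (h : ∀ b b', G₀ (.inl b) → KeyEq (Sum.map fB fC) q (.inl b) (.inl b') → b = b') (b b' : B) :
    GluedClosure (Sum.map fB fC) G₀ st (.inl b) → KeyEq (Sum.map fB fC) q (.inl b) (.inl b') →
      b = b'
  | .inl hG, hk => h b b' hG hk
  | .inr ⟨hs, n, hG⟩, hk => by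
    have hk' := hk.iterate n
    rw [sumMap_iterate_inl] at hG
    rw [sumMap_iterate_inl, sumMap_iterate_inl] at hk'
    exact (hst hs).iterate n (h _ _ hG hk')

theorem GluedClosure.uniq_right (hst : st → Function.Injective fC)
    (h : ∀ c c', G₀ (.inr c) → KeyEq (Sum.map fB fC) q (.inr c) (.inr c') → c = c') (c c' : C) :
    GluedClosure (Sum.map fB fC) G₀ st (.inr c) → KeyEq (Sum.map fB fC) q (.inr c) (.inr c') →
      c = c'
  | .inl hG, hk => h c c' hG hk
  | .inr ⟨hs, n, hG⟩, hk => by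
    have hk' := hk.iterate n
    rw [sumMap_iterate_inr] at hG
    rw [sumMap_iterate_inr, sumMap_iterate_inr] at hk'
    exact (hst hs).iterate n (h _ _ hG hk')

end Glued

/-! ### Cuts of the common substructure -/

section Cuts

variable {A B C : Type} [LinearOrder A] [LinearOrder B] [LinearOrder C]
  (i : A → B) (j : A → C)

/-- `x` is at most the copy of `a` on its side. -/
def Below (x : B ⊕ C) (a : A) : Prop := Sum.elim (· ≤ i a) (· ≤ j a) x

/-- `x` is at least the copy of `a` on its side. -/
def Above (a : A) (x : B ⊕ C) : Prop := Sum.elim (i a ≤ ·) (j a ≤ ·) x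

variable {i j}

theorem below_or_above (x : B ⊕ C) (a : A) : Below i j x a ∨ Above i j a x := by
  rcases x with x | x
  · exact le_total x (i a)
  · exact le_total x (j a)

theorem Below.trans (hi : Monotone i) (hj : Monotone j) {x : B ⊕ C} {a a' : A}
    (h : Below i j x a) (h' : a ≤ a') : Below i j x a' := by
  rcases x with x | x
  · exact le_trans h (hi h')
  · exact le_trans h (hj h')

theorem Above.trans (hi : Monotone i) (hj : Monotone j) {x : B ⊕ C} {a a' : A}
    (h : Above i j a x) (h' : a' ≤ a) : Above i j a' x := by
  rcases x with x | x
  · exact le_trans (hi h') h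
  · exact le_trans (hj h') h

/-- The cut in `A` determined by an element of the disjoint union. -/
def cut (hi : Monotone i) (hj : Monotone j) (x : B ⊕ C) : LowerSet A ×ₗ LowerSet A :=
  toLex (⟨{a | Above i j a x}, fun _ _ h h' => Above.trans hi hj h' h⟩,
    ⟨{a | ¬ Below i j x a}, fun _ _ h h' h'' => h' (Below.trans hi hj h'' h)⟩)

variable {hi : Monotone i} {hj : Monotone j}

theorem above_iff_of_cut_eq {x y : B ⊕ C} (h : cut hi hj x = cut hi hj y) (a : A) :
    Above i j a x ↔ Above i j a y := by
  have := congrArg (fun p => a ∈ (ofLex p).1) h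
  exact iff_of_eq this

theorem below_iff_of_cut_eq {x y : B ⊕ C} (h : cut hi hj x = cut hi hj y) (a : A) :
    Below i j x a ↔ Below i j y a := by
  have := congrArg (fun p => a ∈ (ofLex p).2) h
  exact not_iff_not.1 (iff_of_eq this)

/-- The coordinates of a cut are the sets of a with a ≤ x and with a < x, so a copy of a sits
strictly between the cuts just below and just above it. A strict inequality of cuts is therefore
witnessed by some a lying between x and y and not equal to both. -/
theorem exists_of_cut_lt {x y : B ⊕ C} (h : cut hi hj x < cut hi hj y) :
    ∃ a, Below i j x a ∧ Above i j a y ∧ ¬ (Above i j a x ∧ Below i j y a) := by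
  rcases Prod.Lex.toLex_lt_toLex.1 h with h | h
  · obtain ⟨a, ha, ha'⟩ := Set.not_subset.1 h.not_ge
    exact ⟨a, (below_or_above x a).resolve_right ha', ha, fun h => ha' h.1⟩
  · obtain ⟨a, ha, ha'⟩ := Set.not_subset.1 h.2.not_ge
    exact ⟨a, not_not.1 ha', (below_or_above y a).resolve_left ha, fun h => ha h.2⟩

theorem cut_mono {x y : B ⊕ C} (h : ∀ a, Above i j a x → Above i j a y)
    (h' : ∀ a, Below i j y a → Below i j x a) : cut hi hj x ≤ cut hi hj y :=
  Prod.Lex.toLex_mono ⟨fun a ha => h a ha, fun a ha hb => ha (h' a hb)⟩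

theorem cut_inl_mono {b b' : B} (h : b ≤ b') :
    cut hi hj (.inl b) ≤ cut hi hj (.inl b') :=
  cut_mono (fun _ ha => le_trans ha h) (fun _ ha => le_trans h ha)

theorem cut_inr_mono {c c' : C} (h : c ≤ c') :
    cut hi hj (.inr c) ≤ cut hi hj (.inr c') :=
  cut_mono (fun _ ha => le_trans ha h) (fun _ ha => le_trans h ha)

theorem cut_base (hi' : ∀ a a', i a ≤ i a' ↔ a ≤ a') (hj' : ∀ a a', j a ≤ j a' ↔ a ≤ a') (a : A) :
    cut hi hj (.inl (i a)) = cut hi hj (.inr (j a)) :=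
  le_antisymm (cut_mono (fun _ h => (hj' _ _).2 ((hi' _ _).1 h))
      (fun _ h => (hi' _ _).2 ((hj' _ _).1 h)))
    (cut_mono (fun _ h => (hi' _ _).2 ((hj' _ _).1 h))
      (fun _ h => (hj' _ _).2 ((hi' _ _).1 h)))

variable (i j) in
/-- `x` is the copy of an element of `A`. -/
def InBase (x : B ⊕ C) : Prop := ∃ a, Above i j a x ∧ Below i j x a

theorem InBase.of_cut_eq {x y : B ⊕ C} (h : cut hi hj x = cut hi hj y) (hx : InBase i j x) :
    InBase i j y := by
  obtain ⟨a, ha, ha'⟩ := hx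
  exact ⟨a, (above_iff_of_cut_eq h a).1 ha, (below_iff_of_cut_eq h a).1 ha'⟩

theorem InBase.uniq_left {b b' : B} (h : cut hi hj (.inl b) = cut hi hj (.inl b'))
    (hx : InBase i j (.inl b)) : b = b' := by
  obtain ⟨a, ha, ha'⟩ := hx
  have h₁ := (above_iff_of_cut_eq h a).1 ha
  have h₂ := (below_iff_of_cut_eq h a).1 ha'
  exact (le_antisymm ha' ha).trans (le_antisymm h₁ h₂)

theorem InBase.uniq_right {c c' : C} (h : cut hi hj (.inr c) = cut hi hj (.inr c'))
    (hx : InBase i j (.inr c)) : c = c' := by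
  obtain ⟨a, ha, ha'⟩ := hx
  have h₁ := (above_iff_of_cut_eq h a).1 ha
  have h₂ := (below_iff_of_cut_eq h a).1 ha'
  exact (le_antisymm ha' ha).trans (le_antisymm h₁ h₂)

variable {fA : A → A} {fB : B → B} {fC : C → C}

theorem InBase.map (hiB : ∀ a, fB (i a) = i (fA a)) (hjC : ∀ a, fC (j a) = j (fA a)) {x : B ⊕ C}
    (hx : InBase i j x) : InBase i j (Sum.map fB fC x) := by
  obtain ⟨a, ha, ha'⟩ := hx
  rcases x with x | x
  · obtain rfl : x = i a := le_antisymm ha' ha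
    exact ⟨fA a, (hiB a).ge, (hiB a).le⟩
  · obtain rfl : x = j a := le_antisymm ha' ha
    exact ⟨fA a, (hjC a).ge, (hjC a).le⟩

theorem iterate_base (hiB : ∀ a, fB (i a) = i (fA a)) (n : ℕ) (a : A) :
    fB^[n] (i a) = i (fA^[n] a) := by
  induction n with
  | zero => rfl
  | succ n ih => rw [Function.iterate_succ_apply', ih, hiB, Function.iterate_succ_apply']

/-- A total preorder on the disjoint union which restricts to the given orders and identifies the
two copies of `A`. -/
structure IsUnionOrder (i : A → B) (j : A → C) (R : B ⊕ C → B ⊕ C → Prop) : Prop where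
  trans : ∀ x y z, R x y → R y z → R x z
  total : ∀ x y, R x y ∨ R y x
  inl_iff : ∀ b b', R (.inl b) (.inl b') ↔ b ≤ b'
  inr_iff : ∀ c c', R (.inr c) (.inr c') ↔ c ≤ c'
  base : ∀ a, R (.inl (i a)) (.inr (j a)) ∧ R (.inr (j a)) (.inl (i a))

namespace IsUnionOrder

variable {R : B ⊕ C → B ⊕ C → Prop} (hR : IsUnionOrder i j R)
include hR

theorem of_below {x : B ⊕ C} {a : A} (h : Below i j x a) :
    R x (.inl (i a)) ∧ R x (.inr (j a)) := by
  rcases x with x | x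
  · have := (hR.inl_iff x (i a)).2 h
    exact ⟨this, hR.trans _ _ _ this (hR.base a).1⟩
  · have := (hR.inr_iff x (j a)).2 h
    exact ⟨hR.trans _ _ _ this (hR.base a).2, this⟩

theorem of_above {x : B ⊕ C} {a : A} (h : Above i j a x) :
    R (.inl (i a)) x ∧ R (.inr (j a)) x := by
  rcases x with x | x
  · have := (hR.inl_iff (i a) x).2 h
    exact ⟨this, hR.trans _ _ _ (hR.base a).2 this⟩
  · have := (hR.inr_iff (j a) x).2 h
    exact ⟨hR.trans _ _ _ (hR.base a).1 this, this⟩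

theorem le_of_between {x y : B ⊕ C} {a : A} (h : Below i j x a) (h' : Above i j a y) : R x y :=
  hR.trans _ _ _ (hR.of_below h).1 (hR.of_above h').1

/-- If an injective monotone or antitone operation identifies `x` and `y`, then they determine the
same cut. -/
theorem cut_le_of_map_equiv (hB : Function.Injective fB) (hC : Function.Injective fC)
    (hf : (∀ x y, R x y → R (Sum.map fB fC x) (Sum.map fB fC y)) ∨
      ∀ x y, R x y → R (Sum.map fB fC y) (Sum.map fB fC x)) {x y : B ⊕ C}
    (h₁ : R (Sum.map fB fC x) (Sum.map fB fC y)) (h₂ : R (Sum.map fB fC y) (Sum.map fB fC x)) :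
    cut hi hj y ≤ cut hi hj x := by
  refine le_of_not_gt fun hlt => ?_
  obtain ⟨a, ha, ha', hne⟩ := exists_of_cut_lt hlt
  refine hne ⟨?_, ?_⟩
  -- If the cut of x were smaller, some a would lie between x and y, and the operation would
  -- identify x, a and y. Injectivity on the side of x makes x the copy of a, and likewise for y,
  -- contradicting the choice of a. Both copies of a are used because the sides of x and y are
  -- unknown.
  · have e₁ := (squeeze_op hR.trans hf (hR.of_below ha).1 (hR.of_above ha').1 h₁ h₂).1
    have e₂ := (squeeze_op hR.trans hf (hR.of_below ha).2 (hR.of_above ha').2 h₁ h₂).1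
    rcases x with x | x
    · exact (hB (le_antisymm ((hR.inl_iff _ _).1 e₁.1) ((hR.inl_iff _ _).1 e₁.2))).ge
    · exact (hC (le_antisymm ((hR.inr_iff _ _).1 e₂.1) ((hR.inr_iff _ _).1 e₂.2))).ge
  · have e₁ := (squeeze_op hR.trans hf (hR.of_below ha).1 (hR.of_above ha').1 h₁ h₂).2
    have e₂ := (squeeze_op hR.trans hf (hR.of_below ha).2 (hR.of_above ha').2 h₁ h₂).2
    rcases y with y | y
    · exact (hB (le_antisymm ((hR.inl_iff _ _).1 e₁.1) ((hR.inl_iff _ _).1 e₁.2))).ge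
    · exact (hC (le_antisymm ((hR.inr_iff _ _).1 e₂.1) ((hR.inr_iff _ _).1 e₂.2))).ge

end IsUnionOrder

end Cuts


/-! ### Linear orders on the union compatible with the operation -/

section UnionOrders

variable {A B C : Type} [LinearOrder A] [LinearOrder B] [LinearOrder C]
  {i : A → B} {j : A → C} {fA : A → A} {fB : B → B} {fC : C → C}

theorem LexHyp.isUnionOrder {Q : Type} {q : B ⊕ C → Q} {r : ℕ → Q → Q → Prop}
    {G o : B ⊕ C → Prop} (h : LexHyp (Sum.map fB fC) q r G o)
    (hiB : ∀ a, fB (i a) = i (fA a)) (hjC : ∀ a, fC (j a) = j (fA a))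
    (hq : ∀ a, q (.inl (i a)) = q (.inr (j a)))
    (hG : ∀ a, G (.inl (i a)) ∧ G (.inr (j a))) :
    IsUnionOrder i j (LexLe (Sum.map fB fC) q r G o) where
  trans := h.lexLe_trans
  total := h.lexLe_total
  inl_iff := h.lexLe_inl
  inr_iff := h.lexLe_inr
  base a := by
    have hk : KeyEq (Sum.map fB fC) q (.inl (i a)) (.inr (j a)) := by
      intro n
      rw [sumMap_iterate_inl, sumMap_iterate_inr, iterate_base hiB, iterate_base hjC, hq]
    exact ⟨lexLe_of_glued (hG a).1 (hG a).2 hk (by simp),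
      lexLe_of_glued (hG a).2 (hG a).1 hk.symm (by simp)⟩

theorem inBase_base (a : A) : InBase i j (.inl (i a)) ∧ InBase i j (.inr (j a)) :=
  ⟨⟨a, le_refl (i a), le_refl (i a)⟩, ⟨a, le_refl (j a), le_refl (j a)⟩⟩

theorem sumMap_isLeft (x : B ⊕ C) : (Sum.map fB fC x).isLeft = x.isLeft := by
  rcases x with x | x <;> rfl

/-- The key of x is the sequence of cuts of its iterates; applying the operation shifts the
sequence. The proposition `st` switches on the extra gluing that strictness requires, so that one
construction serves the weak and the strict classes. -/
theorem exists_unionOrder_of_monotone (hi : ∀ a a', i a ≤ i a' ↔ a ≤ a')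
    (hj : ∀ a a', j a ≤ j a' ↔ a ≤ a') (hiB : ∀ a, fB (i a) = i (fA a))
    (hjC : ∀ a, fC (j a) = j (fA a)) (hB : Monotone fB) (hC : Monotone fC) (st : Prop)
    (hst : st → Function.Injective fB ∧ Function.Injective fC) :
    ∃ R : B ⊕ C → B ⊕ C → Prop, IsUnionOrder i j R ∧
      (∀ x y, R x y → R (Sum.map fB fC x) (Sum.map fB fC y)) ∧
      (st → ∀ x y, R (Sum.map fB fC x) (Sum.map fB fC y) →
        R (Sum.map fB fC y) (Sum.map fB fC x) → R x y) := by
  have hi' : Monotone i := fun a a' h => (hi a a').2 h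
  have hj' : Monotone j := fun a a' h => (hj a a').2 h
  set f := Sum.map fB fC with hf
  let q : B ⊕ C → _ := cut hi' hj'
  let r : ℕ → (LowerSet A ×ₗ LowerSet A) → (LowerSet A ×ₗ LowerSet A) → Prop := fun _ u v => u < v
  let G : B ⊕ C → Prop := GluedClosure f (InBase i j) st
  have hinv : ∀ x y, KeyEq f q x y → InBase i j x → InBase i j y := fun x y h =>
    InBase.of_cut_eq (h 0)
  -- Unglued ties always put B first, a choice that the operation preserves.
  have hL : LexHyp f q r G (fun _ => True) := by
    refine ⟨fun n => inferInstanceAs (IsStrictTotalOrder _ (· < ·)), GluedClosure.inv hinv,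
      fun _ _ _ h => h,
      fun b b' h h' => GluedClosure.uniq_left (fun h => (hst h).1)
        (fun b b' hG hk => hG.uniq_left (hk 0)) b b' h h',
      fun b b' h h' => GluedClosure.uniq_right (fun h => (hst h).2)
        (fun b b' hG hk => hG.uniq_right (hk 0)) b b' h h', ?_, ?_⟩
    · rintro b b' hb ⟨n, -, hn⟩
      rw [hf, sumMap_iterate_inl, sumMap_iterate_inl] at hn
      exact not_lt_of_ge (cut_inl_mono (hB.iterate n hb)) hn
    · rintro b b' hb ⟨n, -, hn⟩
      rw [hf, sumMap_iterate_inr, sumMap_iterate_inr] at hn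
      exact not_lt_of_ge (cut_inr_mono (hC.iterate n hb)) hn
  have hU : IsUnionOrder i j (LexLe f q r G (fun _ => True)) :=
    hL.isUnionOrder hiB hjC (cut_base hi hj) fun a => (inBase_base a).imp .inl .inl
  have hmono : ∀ x y, LexLe f q r G (fun _ => True) x y →
      LexLe f q r G (fun _ => True) (f x) (f y) := by
    rintro x y (⟨n, hn, hlt⟩ | ⟨hk, ht⟩)
    · cases n with
      | zero =>
        -- When the difference is in the first entry, the shift loses it; but an element a between x
        -- and y is mapped between their images.
        obtain ⟨a, ha, ha', -⟩ := exists_of_cut_lt hlt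
        refine hU.le_of_between (a := fA a) ?_ ?_
        · rcases x with x | x
          · exact (hB ha).trans (hiB a).le
          · exact (hC ha).trans (hjC a).le
        · rcases y with y | y
          · exact (hiB a).ge.trans (hB ha')
          · exact (hjC a).ge.trans (hC ha')
      | succ n => exact .inl ⟨n, fun m hm => hn (m + 1) (by omega), hlt⟩
    · refine .inr ⟨hk.map, ?_⟩
      rcases x with x | x <;> rcases y with y | y
      · exact hB ht
      · exact .inr trivial
      · rcases ht with ht | ht
        · exact .inl (GluedClosure.map (fun x hx => hx.map hiB hjC) _ ht)
        · exact (ht trivial).elim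
      · exact hC ht
  refine ⟨_, hU, hmono, fun hs => ?_⟩
  refine hL.lexLe_of_map_equiv ?_ ?_ ?_ (fun x => sumMap_isLeft x) ?_
  · intro x y h₁ h₂
    exact le_antisymm (hU.cut_le_of_map_equiv (hst hs).1 (hst hs).2 (.inl hmono) h₂ h₁)
      (hU.cut_le_of_map_equiv (hst hs).1 (hst hs).2 (.inl hmono) h₁ h₂)
  · exact fun b b' h => (hst hs).1 (Sum.inl_injective h)
  · exact fun c c' h => (hst hs).2 (Sum.inr_injective h)
  · exact fun x => GluedClosure.of_map hs x

/-- The position of `b` relative to the centre of an antitone operation. -/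
def pos (f : B → B) (b : B) : ℤ := if b < f b then -1 else if f b < b then 1 else 0

theorem pos_nonpos_iff {f : B → B} {b : B} : pos f b ≤ 0 ↔ b ≤ f b := by
  unfold pos
  split_ifs with h h'
  · simp [h.le]
  · simp [h']
  · simp [not_lt.1 h']

theorem pos_nonneg_iff {f : B → B} {b : B} : 0 ≤ pos f b ↔ f b ≤ b := by
  unfold pos
  split_ifs with h h'
  · simp [h]
  · simp [h'.le]
  · simp [not_lt.1 h]

theorem pos_eq_zero_iff {f : B → B} {b : B} : pos f b = 0 ↔ f b = b := by
  rw [le_antisymm_iff, pos_nonneg_iff, pos_nonpos_iff, le_antisymm_iff, and_comm]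

theorem pos_mem (f : B → B) (b : B) : -1 ≤ pos f b ∧ pos f b ≤ 1 := by
  unfold pos
  split_ifs <;> simp

theorem pos_mono {f : B → B} (hf : Antitone f) {b b' : B} (h : b ≤ b') : pos f b ≤ pos f b' := by
  have h' := hf h
  have hb := pos_mem f b
  have hb' := pos_mem f b'
  by_contra hlt
  rcases le_or_gt 0 (pos f b') with h0 | h0
  · have h1 : ¬ pos f b ≤ 0 := by omega
    rw [pos_nonpos_iff, not_le] at h1
    have h2 : pos f b' = 0 := by omega
    rw [pos_eq_zero_iff] at h2
    exact absurd (h1.trans_le (h.trans (h2.ge.trans h'))) (lt_irrefl _)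
  · have h1 : 0 ≤ pos f b := by omega
    have h0' : ¬ 0 ≤ pos f b' := by omega
    rw [pos_nonneg_iff] at h1 h0'
    exact h0' (h'.trans (h1.trans h))

theorem pos_map_nonneg {f : B → B} (hf : Antitone f) {b : B} (h : pos f b ≤ 0) :
    0 ≤ pos f (f b) := by
  rw [pos_nonneg_iff]
  exact hf (pos_nonpos_iff.1 h)

theorem pos_map_nonpos {f : B → B} (hf : Antitone f) {b : B} (h : 0 ≤ pos f b) :
    pos f (f b) ≤ 0 := by
  rw [pos_nonpos_iff]
  exact hf (pos_nonneg_iff.1 h)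

theorem eq_of_fixed {f : B → B} (hf : Antitone f) {b b' : B} (h : f b = b) (h' : f b' = b') :
    b = b' := by
  rcases le_total b b' with hb | hb
  · have := hf hb
    rw [h, h'] at this
    exact le_antisymm hb this
  · have := hf hb
    rw [h, h'] at this
    exact le_antisymm this hb

theorem pos_base (hi : ∀ a a', i a ≤ i a' ↔ a ≤ a') (hiB : ∀ a, fB (i a) = i (fA a)) (a : A) :
    pos fB (i a) = pos fA a := by
  have : ∀ a a', i a < i a' ↔ a < a' := fun a a' => by rw [← not_le, hi, not_le]
  simp only [pos, hiB, this]

/-- The criterion refers to A alone, so all fixed points, in B or in C, have the same cut and can be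
identified. -/
theorem base_le_fixed_iff (hi : ∀ a a', i a ≤ i a' ↔ a ≤ a') (hiB : ∀ a, fB (i a) = i (fA a))
    (hB : Antitone fB) {b : B} (hb : fB b = b) (a : A) : i a ≤ b ↔ a ≤ fA a := by
  constructor
  · intro h
    have := hB h
    rw [hb, hiB] at this
    exact (hi _ _).1 (h.trans this)
  · intro h
    by_contra hlt
    have h' := hB (not_le.1 hlt).le
    rw [hb, hiB] at h'
    exact hlt (((hi _ _).2 h).trans h')

theorem fixed_le_base_iff (hi : ∀ a a', i a ≤ i a' ↔ a ≤ a') (hiB : ∀ a, fB (i a) = i (fA a))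
    (hB : Antitone fB) {b : B} (hb : fB b = b) (a : A) : b ≤ i a ↔ fA a ≤ a := by
  constructor
  · intro h
    have := hB h
    rw [hb, hiB] at this
    exact (hi _ _).1 (this.trans h)
  · intro h
    by_contra hlt
    have h' := hB (not_le.1 hlt).le
    rw [hb, hiB] at h'
    exact hlt (h'.trans ((hi _ _).2 h))

theorem iterate_parity_strict {Q : Type} [LinearOrder Q] (n : ℕ) :
    IsStrictTotalOrder Q (fun u v => if Even n then u < v else v < u) := by
  by_cases h : Even n
  · simp only [h, if_true]
    exact inferInstanceAs (IsStrictTotalOrder Q (· < ·))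
  · simp only [h, if_false]
    exact inferInstanceAs (IsStrictTotalOrder Q (· > ·))

theorem iterate_antitone {f : B → B} (hf : Antitone f) (n : ℕ) :
    (Even n → Monotone f^[n]) ∧ (¬ Even n → Antitone f^[n]) := by
  induction n with
  | zero => exact ⟨fun _ => monotone_id, fun h => (h (by simp)).elim⟩
  | succ n ih =>
    rw [Nat.even_add_one, Function.iterate_succ', not_not]
    exact ⟨fun h => hf.comp (ih.2 h), fun h => hf.comp_monotone (ih.1 h)⟩

/-- Each entry of the key now starts with the side of the centre, followed by the cut, and the order
of entries alternates with the parity of the index because every application of the operation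
reverses it. -/
theorem exists_unionOrder_of_antitone (hi : ∀ a a', i a ≤ i a' ↔ a ≤ a')
    (hj : ∀ a a', j a ≤ j a' ↔ a ≤ a') (hiB : ∀ a, fB (i a) = i (fA a))
    (hjC : ∀ a, fC (j a) = j (fA a)) (hB : Antitone fB) (hC : Antitone fC) (st : Prop)
    (hst : st → Function.Injective fB ∧ Function.Injective fC) :
    ∃ R : B ⊕ C → B ⊕ C → Prop, IsUnionOrder i j R ∧
      (∀ x y, R x y → R (Sum.map fB fC y) (Sum.map fB fC x)) ∧
      (st → ∀ x y, R (Sum.map fB fC x) (Sum.map fB fC y) →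
        R (Sum.map fB fC y) (Sum.map fB fC x) → R x y) := by
  have hi' : Monotone i := fun a a' h => (hi a a').2 h
  have hj' : Monotone j := fun a a' h => (hj a a').2 h
  set f := Sum.map fB fC with hf
  let s : B ⊕ C → ℤ := Sum.elim (pos fB) (pos fC)
  let q : B ⊕ C → ℤ ×ₗ (LowerSet A ×ₗ LowerSet A) := fun x => toLex (s x, cut hi' hj' x)
  have q_eq : ∀ {x y}, q x = q y ↔ s x = s y ∧ cut hi' hj' x = cut hi' hj' y := by
    intro x y
    exact ⟨fun h => ⟨congrArg (fun p => (ofLex p).1) h, congrArg (fun p => (ofLex p).2) h⟩,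
      fun h => by simp only [q, h.1, h.2]⟩
  let r : ℕ → (ℤ ×ₗ (LowerSet A ×ₗ LowerSet A)) → (ℤ ×ₗ (LowerSet A ×ₗ LowerSet A)) → Prop :=
    fun n u v => if Even n then u < v else v < u
  -- An antitone map of a linear order has at most one fixed point, so the fixed points of B and C
  -- must be glued even outside A.
  let G₀ : B ⊕ C → Prop := fun x => InBase i j x ∨ s x = 0
  let G : B ⊕ C → Prop := GluedClosure f G₀ st
  -- B comes first to the left of the centre and C to the right; the operation exchanges the sides,
  -- and so respects the tie rule.
  let o : B ⊕ C → Prop := fun x => s x < 0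
  have s_zero : ∀ x, s x = 0 ↔ f x = x := by
    rintro (x | x)
    · exact pos_eq_zero_iff.trans Sum.inl_injective.eq_iff.symm
    · exact pos_eq_zero_iff.trans Sum.inr_injective.eq_iff.symm
  have s_nonneg : ∀ x, s x ≤ 0 → 0 ≤ s (f x) := by
    rintro (x | x) h
    · exact pos_map_nonneg hB h
    · exact pos_map_nonneg hC h
  have s_nonpos : ∀ x, 0 ≤ s x → s (f x) ≤ 0 := by
    rintro (x | x) h
    · exact pos_map_nonpos hB h
    · exact pos_map_nonpos hC h
  have s_mem : ∀ x, -1 ≤ s x ∧ s x ≤ 1 := by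
    rintro (x | x)
    · exact pos_mem fB x
    · exact pos_mem fC x
  have hinv : ∀ x y, KeyEq f q x y → G₀ x → G₀ y := fun x y h =>
    Or.imp (InBase.of_cut_eq (q_eq.1 (h 0)).2) fun hx => (q_eq.1 (h 0)).1.symm.trans hx
  have hG₀ : ∀ x, G₀ x → G₀ (f x) := fun x => Or.imp (fun hx => hx.map hiB hjC) fun hx => by
    rw [(s_zero x).1 hx, hx]
  have q_inl : ∀ {b b'}, b ≤ b' → q (.inl b) ≤ q (.inl b') := fun h =>
    Prod.Lex.toLex_mono ⟨pos_mono hB h, cut_inl_mono (hi := hi') (hj := hj') h⟩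
  have q_inr : ∀ {c c'}, c ≤ c' → q (.inr c) ≤ q (.inr c') := fun h =>
    Prod.Lex.toLex_mono ⟨pos_mono hC h, cut_inr_mono (hi := hi') (hj := hj') h⟩
  have hL : LexHyp f q r G o := by
    refine ⟨fun n => iterate_parity_strict n, GluedClosure.inv hinv,
      fun x y h hx => (q_eq.1 (h 0)).1.symm.trans_lt hx,
      fun b b' h h' => GluedClosure.uniq_left (fun h => (hst h).1) ?_ b b' h h',
      fun b b' h h' => GluedClosure.uniq_right (fun h => (hst h).2) ?_ b b' h h', ?_, ?_⟩
    · rintro b b' (hG | hG) hk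
      · exact hG.uniq_left (q_eq.1 (hk 0)).2
      · exact eq_of_fixed hB (pos_eq_zero_iff.1 hG)
          (pos_eq_zero_iff.1 ((q_eq.1 (hk 0)).1.symm.trans hG))
    · rintro b b' (hG | hG) hk
      · exact hG.uniq_right (q_eq.1 (hk 0)).2
      · exact eq_of_fixed hC (pos_eq_zero_iff.1 hG)
          (pos_eq_zero_iff.1 ((q_eq.1 (hk 0)).1.symm.trans hG))
    · rintro b b' hb ⟨n, -, hn⟩
      rw [hf, sumMap_iterate_inl, sumMap_iterate_inl] at hn
      simp only [r] at hn
      split_ifs at hn with he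
      · exact not_lt_of_ge (q_inl ((iterate_antitone hB n).1 he hb)) hn
      · exact not_lt_of_ge (q_inl ((iterate_antitone hB n).2 he hb)) hn
    · rintro b b' hb ⟨n, -, hn⟩
      rw [hf, sumMap_iterate_inr, sumMap_iterate_inr] at hn
      simp only [r] at hn
      split_ifs at hn with he
      · exact not_lt_of_ge (q_inr ((iterate_antitone hC n).1 he hb)) hn
      · exact not_lt_of_ge (q_inr ((iterate_antitone hC n).2 he hb)) hn
  have hU : IsUnionOrder i j (LexLe f q r G o) :=
    hL.isUnionOrder hiB hjC
      (fun a => q_eq.2 ⟨(pos_base hi hiB a).trans (pos_base hj hjC a).symm, cut_base hi hj a⟩)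
      fun a => (inBase_base a).imp (fun h => .inl (.inl h)) (fun h => .inl (.inl h))
  have cut_fixed : ∀ x y, s x = 0 → s y = 0 → cut hi' hj' x ≤ cut hi' hj' y := by
    have above : ∀ x a, s x = 0 → (Above i j a x ↔ a ≤ fA a) := by
      rintro (x | x) a hx
      · exact base_le_fixed_iff hi hiB hB (pos_eq_zero_iff.1 hx) a
      · exact base_le_fixed_iff hj hjC hC (pos_eq_zero_iff.1 hx) a
    have below : ∀ x a, s x = 0 → (Below i j x a ↔ fA a ≤ a) := by
      rintro (x | x) a hx
      · exact fixed_le_base_iff hi hiB hB (pos_eq_zero_iff.1 hx) a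
      · exact fixed_le_base_iff hj hjC hC (pos_eq_zero_iff.1 hx) a
    intro x y hx hy
    exact cut_mono (fun a h => (above y a hy).2 ((above x a hx).1 h))
      fun a h => (below x a hx).2 ((below y a hy).1 h)
  have le_fixed : ∀ x y, s x = 0 → s y = 0 → LexLe f q r G o x y := by
    intro x y hx hy
    have hk : KeyEq f q x y := by
      intro n
      rw [Function.iterate_fixed ((s_zero x).1 hx), Function.iterate_fixed ((s_zero y).1 hy)]
      exact q_eq.2 ⟨hx.trans hy.symm, le_antisymm (cut_fixed x y hx hy) (cut_fixed y x hy hx)⟩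
    rcases x with x | x <;> rcases y with y | y
    · exact (hL.lexLe_inl _ _).2
        (eq_of_fixed hB (pos_eq_zero_iff.1 hx) (pos_eq_zero_iff.1 hy)).le
    · exact lexLe_of_glued (.inl (.inr hx)) (.inl (.inr hy)) hk (by simp)
    · exact lexLe_of_glued (.inl (.inr hx)) (.inl (.inr hy)) hk (by simp)
    · exact (hL.lexLe_inr _ _).2
        (eq_of_fixed hC (pos_eq_zero_iff.1 hx) (pos_eq_zero_iff.1 hy)).le
  have s_map : ∀ x y, s x < s y → s (f y) ≤ 0 ∧ 0 ≤ s (f x) := by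
    intro x y hlt
    have := s_mem x
    have := s_mem y
    exact ⟨s_nonpos y (by omega), s_nonneg x (by omega)⟩
  have hanti : ∀ x y, LexLe f q r G o x y → LexLe f q r G o (f y) (f x) := by
    rintro x y (⟨n, hn, hlt⟩ | ⟨hk, ht⟩)
    · cases n with
      | zero =>
        simp only [r, Even.zero, if_true] at hlt
        -- On different sides, the images are weakly on opposite sides in the reverse order; they
        -- fail to be separated only when both are the fixed point. On the same side, an element of
        -- A lies between.
        rcases Prod.Lex.toLex_lt_toLex.1 hlt with hs | ⟨-, hc⟩
        · obtain ⟨h₁, h₂⟩ := s_map x y hs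
          rcases lt_or_eq_of_le (h₁.trans h₂) with h₃ | h₃
          · refine .inl ⟨0, fun m hm => absurd hm (Nat.not_lt_zero m), ?_⟩
            simp only [r, Even.zero, if_true]
            exact Prod.Lex.toLex_lt_toLex.2 (.inl h₃)
          · exact le_fixed _ _ (by omega) (by omega)
        · obtain ⟨a, ha, ha', -⟩ := exists_of_cut_lt (hi := hi') (hj := hj') hc
          refine hU.le_of_between (a := fA a) ?_ ?_
          · rcases y with y | y
            · exact (hB ha').trans (hiB a).le
            · exact (hC ha').trans (hjC a).le
          · rcases x with x | x
            · exact (hiB a).ge.trans (hB ha)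
            · exact (hjC a).ge.trans (hC ha)
      | succ n =>
        refine .inl ⟨n, fun m hm => (hn (m + 1) (by omega)).symm, ?_⟩
        -- Dropping the first entry changes the parity of the index, which is the reversal wanted.
        simp only [r, Nat.even_add_one] at hlt ⊢
        split_ifs at hlt ⊢ with he
        · exact hlt
        · exact hlt
    · refine .inr ⟨hk.symm.map, ?_⟩
      have hks : s (f x) = s (f y) := (q_eq.1 (hk 1)).1
      have hks' : s x = s y := (q_eq.1 (hk 0)).1
      rcases x with x | x <;> rcases y with y | y
      · exact hB ht
      · rcases ht with ht | ht
        · exact .inl (GluedClosure.inv hinv _ _ hk.map (GluedClosure.map hG₀ _ ht))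
        · exact .inr (not_lt_of_ge (hks.symm ▸ s_nonneg _ (le_of_lt ht)))
      · rcases ht with ht | ht
        · exact .inl (GluedClosure.inv hinv _ _ hk.map (GluedClosure.map hG₀ _ ht))
        · have := s_nonpos _ (not_lt.1 ht)
          rw [hks] at this
          -- An element to the right may be mapped to the centre itself, where `o` fails; there the
          -- images are glued instead.
          rcases lt_or_eq_of_le this with h' | h'
          · exact .inr h'
          · exact .inl (.inl (.inr h'))
      · exact hC ht
  refine ⟨_, hU, hanti, fun hs => ?_⟩
  have hinj : Function.Injective f := Sum.map_injective.2 (hst hs)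
  -- An injective operation sends only its fixed point to the fixed point, so strictly different
  -- sides cannot be merged by it.
  have hzero : ∀ x, s (f x) = 0 → s x = 0 := fun x hx => (s_zero x).2 (hinj ((s_zero _).1 hx))
  have s_le : ∀ x y, s (f x) = s (f y) → s x ≤ s y := by
    intro x y h
    by_contra hlt
    obtain ⟨h₁, h₂⟩ := s_map y x (not_le.1 hlt)
    have h₃ := hzero x (by omega)
    have h₄ := hzero y (by omega)
    omega
  refine hL.lexLe_of_map_equiv ?_ ?_ ?_ (fun x => sumMap_isLeft x) ?_
  · intro x y h₁ h₂
    have hk : s (f x) = s (f y) := (q_eq.1 (hL.keyEq_of_equiv h₁ h₂ 0)).1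
    exact q_eq.2 ⟨le_antisymm (s_le x y hk) (s_le y x hk.symm),
      le_antisymm (hU.cut_le_of_map_equiv (hst hs).1 (hst hs).2 (.inr hanti) h₂ h₁)
      (hU.cut_le_of_map_equiv (hst hs).1 (hst hs).2 (.inr hanti) h₁ h₂)⟩
  · exact fun b b' h => (hst hs).1 (Sum.inl_injective h)
  · exact fun c c' h => (hst hs).2 (Sum.inr_injective h)
  · exact fun x => GluedClosure.of_map hs x

end UnionOrders

/-! ### Amalgamation of the four classes of linear orders -/

section LinearClasses

variable {F : Type}

/-- The linear order given by the interpretation of the symbol `≤`. -/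
noncomputable abbrev linearOrderOf {A : Type} [(lang F).Structure A]
    (h : IsLinearOrder A (le (F := F) A)) : LinearOrder A where
  le := le (F := F) A
  le_refl := refl_of (le (F := F) A)
  le_trans _ _ _ := trans_of (le (F := F) A)
  le_antisymm _ _ := antisymm_of (le (F := F) A)
  le_total := total_of (le (F := F) A)
  toDecidableLE := Classical.decRel _

theorem injective_op_of_lt_ne {A : Type} [(lang F).Structure A]
    (h : IsLinearOrder A (le (F := F) A)) {k : F}
    (hs : ∀ a b, lt (F := F) A a b → op A k a ≠ op A k b) : Function.Injective (op A k) := by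
  intro a b hab
  by_contra hne
  rcases total_of (le (F := F) A) a b with hle | hle
  · exact hs a b ⟨hle, hne⟩ hab
  · exact hs b a ⟨hle, Ne.symm hne⟩ hab.symm

theorem exists_amalgam_linear {K : StrClass (lang Unit)} (A B C : Bundled.{0} (lang Unit).Structure)
    (i : A ↪[lang Unit] B) (j : A ↪[lang Unit] C)
    (hB : IsLinearOrder B (le (F := Unit) B))
    (hC : IsLinearOrder C (le (F := Unit) C)) (R : B ⊕ C → B ⊕ C → Prop)
    (hR : @IsUnionOrder A B C (linearOrderOf hB) (linearOrderOf hC) i j R)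
    (hop : ∀ x y, R x y → R y x → R (sumOp B C () x) (sumOp B C () y))
    (hK : ∀ (D : Bundled.{0} (lang Unit).Structure) (π : B ⊕ C → D), IsGluing (F := Unit) R π →
      IsLinearOrder D (le (F := Unit) D) → D ∈ K) :
    ∃ D ∈ K, ∃ (p : B ↪[lang Unit] D) (q : C ↪[lang Unit] D), p.comp i = q.comp j ∧
      ∀ d, (∃ b, p b = d) ∨ ∃ c, q c = d := by
  let _ := linearOrderOf hB
  let _ := linearOrderOf hC
  exact exists_amalgam A B C i j R (fun x => or_self_iff.1 (hR.total x x)) hR.trans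
    (fun _ => hop) hR.inl_iff hR.inr_iff hR.base
    fun D π h => hK D π h (h.isLinearOrder hR.trans hR.total)

/-- Taking `st` to be `False` gives the order preserving class and `True` the strict one, where
strictness on a linear order yields the required injectivity. -/
theorem exists_amalgam_preserving {K : StrClass (lang Unit)} (st : Prop)
    (A B C : Bundled.{0} (lang Unit).Structure)
    (i : A ↪[lang Unit] B) (j : A ↪[lang Unit] C) (hA : A ∈ LOp) (hB : B ∈ LOp) (hC : C ∈ LOp)
    (hst : st → Function.Injective (op (F := Unit) B ()) ∧ Function.Injective (op (F := Unit) C ()))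
    (hK : ∀ D ∈ LOp, (st → StrictOrderPreserving (F := Unit) D ()) → D ∈ K) :
    ∃ D ∈ K, ∃ (p : B ↪[lang Unit] D) (q : C ↪[lang Unit] D), p.comp i = q.comp j ∧
      ∀ d, (∃ b, p b = d) ∨ ∃ c, q c = d := by
  let _ := linearOrderOf hA.1
  let _ := linearOrderOf hB.1
  let _ := linearOrderOf hC.1
  obtain ⟨R, hR, hf, hs⟩ := exists_unionOrder_of_monotone (i := i) (j := j) (fA := op A ())
    (fB := op B ()) (fC := op C ()) (le_map i) (le_map j) (fun a => (op_map i () a).symm)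
    (fun a => (op_map j () a).symm) (fun a b => hB.2 a b) (fun a b => hC.2 a b) st hst
  refine exists_amalgam_linear A B C i j hB.1 hC.1 R hR (fun x y h _ => hf x y h)
    fun D π h hD => hK D ⟨hD, h.orderPreserving () hf⟩ fun t => h.strictOrderPreserving () ?_
  exact fun x y hxy hyx => ⟨hf x y hxy, fun h' => hyx (hs t y x h' (hf x y hxy))⟩

theorem exists_amalgam_reversing {K : StrClass (lang Unit)} (st : Prop)
    (A B C : Bundled.{0} (lang Unit).Structure)
    (i : A ↪[lang Unit] B) (j : A ↪[lang Unit] C) (hA : A ∈ LOr) (hB : B ∈ LOr) (hC : C ∈ LOr)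
    (hst : st → Function.Injective (op (F := Unit) B ()) ∧ Function.Injective (op (F := Unit) C ()))
    (hK : ∀ D ∈ LOr, (st → StrictOrderReversing (F := Unit) D ()) → D ∈ K) :
    ∃ D ∈ K, ∃ (p : B ↪[lang Unit] D) (q : C ↪[lang Unit] D), p.comp i = q.comp j ∧
      ∀ d, (∃ b, p b = d) ∨ ∃ c, q c = d := by
  let _ := linearOrderOf hA.1
  let _ := linearOrderOf hB.1
  let _ := linearOrderOf hC.1
  obtain ⟨R, hR, hf, hs⟩ := exists_unionOrder_of_antitone (i := i) (j := j) (fA := op A ())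
    (fB := op B ()) (fC := op C ()) (le_map i) (le_map j) (fun a => (op_map i () a).symm)
    (fun a => (op_map j () a).symm) (fun a b => hB.2 a b) (fun a b => hC.2 a b) st hst
  refine exists_amalgam_linear A B C i j hB.1 hC.1 R hR (fun x y _ h => hf y x h)
    fun D π h hD => hK D ⟨hD, h.orderReversing () hf⟩ fun t => h.strictOrderReversing () ?_
  exact fun x y hxy hyx => ⟨hf x y hxy, fun h' => hyx (hs t y x (hf x y hxy) h')⟩

theorem LOsp_subset_LOp : LOsp ⊆ LOp := fun _ hA =>
  have := hA.1
  ⟨hA.1, hA.2.orderPreserving⟩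

theorem LOsr_subset_LOr : LOsr ⊆ LOr := fun _ hA =>
  have := hA.1
  ⟨hA.1, hA.2.orderReversing⟩

theorem unionAmalgamation_LOp : UnionAmalgamation LOp := fun A B C i j hA hB hC =>
  exists_amalgam_preserving False A B C i j hA hB hC False.elim fun _ hD _ => hD

theorem unionAmalgamation_LOr : UnionAmalgamation LOr := fun A B C i j hA hB hC =>
  exists_amalgam_reversing False A B C i j hA hB hC False.elim fun _ hD _ => hD

theorem unionAmalgamation_LOsp : UnionAmalgamation LOsp := fun A B C i j hA hB hC =>
  exists_amalgam_preserving True A B C i j (LOsp_subset_LOp hA) (LOsp_subset_LOp hB)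
    (LOsp_subset_LOp hC)
    (fun _ => ⟨injective_op_of_lt_ne hB.1 fun a b h => (hB.2 a b h).2,
      injective_op_of_lt_ne hC.1 fun a b h => (hC.2 a b h).2⟩)
    fun _ hD hs => ⟨hD.1, hs trivial⟩

theorem unionAmalgamation_LOsr : UnionAmalgamation LOsr := fun A B C i j hA hB hC =>
  exists_amalgam_reversing True A B C i j (LOsr_subset_LOr hA) (LOsr_subset_LOr hB)
    (LOsr_subset_LOr hC)
    (fun _ => ⟨injective_op_of_lt_ne hB.1 fun a b h => (hB.2 a b h).2.symm,
      injective_op_of_lt_ne hC.1 fun a b h => (hC.2 a b h).2.symm⟩)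
    fun _ hD hs => ⟨hD.1, hs trivial⟩

end LinearClasses

/-! ### Finite descriptions of the comparison of two orbits of a monotone map -/

section OrbitComparison

/-- For each d the set of k is an up-set of ℕ, growing with d. The least k that ever occurs does so
at some N, after which nothing can be added. -/
theorem exists_stable_of_mono {P : ℕ → ℕ → Prop} (hk : ∀ d k, P d k → P d (k + 1))
    (hd : ∀ d k, P d k → P (d + 1) k) : ∃ N, ∀ d, N ≤ d → ∀ k, P d k ↔ P N k := by
  classical
  have hk' : ∀ d {k k'}, k ≤ k' → P d k → P d k' := fun d _ _ h hP =>
    Nat.le_induction hP (fun n _ ih => hk d n ih) _ h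
  have hd' : ∀ {d d'} k, d ≤ d' → P d k → P d' k := fun k h hP =>
    Nat.le_induction hP (fun n _ ih => hd n k ih) _ h
  by_cases h : ∃ k d, P d k
  · obtain ⟨N, hN⟩ := Nat.find_spec h
    exact ⟨N, fun d hNd k => ⟨fun hP => hk' N (Nat.find_min' h ⟨d, hP⟩) hN, hd' k hNd⟩⟩
  · push Not at h
    exact ⟨0, fun d _ k => iff_of_false (h k d) (h k 0)⟩

theorem exists_threshold {P : ℕ → Prop} (hP : ∀ k, P k → P (k + 1)) :
    ∃ θ : Option ℕ, ∀ k, P k ↔ ∃ m, θ = some m ∧ m ≤ k := by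
  classical
  by_cases h : ∃ k, P k
  · refine ⟨some (Nat.find h), fun k => ⟨fun hk => ⟨_, rfl, Nat.find_min' h hk⟩, ?_⟩⟩
    rintro ⟨m, hm, hmk⟩
    obtain rfl := Option.some.inj hm
    exact Nat.le_induction (Nat.find_spec h) (fun n _ ih => hP n ih) _ hmk
  · push Not at h
    exact ⟨none, fun k => iff_of_false (h k) (by simp)⟩

variable {A : Type} [LinearOrder A] {g : A → A}

/-- If the orbit of x decreases, the comparison is monotone in d as well as in k, hence a fixed
threshold in k for large d. If it increases, the reverse comparison has such a threshold t: below t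
the inequality holds strictly, and from t on it can only be an equality. Such an equality for large
d forces both orbits to have reached a common fixed point, and e and e' record when they do. -/
theorem exists_tail_comparison (hg : Monotone g) (x y : A) :
    ∃ (N t e e' : ℕ) (β : Bool), ∀ d, N ≤ d → ∀ k,
      g^[k + d] x ≤ g^[k] y ↔ k < t ∨ (β = true ∧ e ≤ k + d ∧ e' ≤ k) := by
  rcases le_total (g x) x with hx | hx
  · obtain ⟨N, hN⟩ := exists_stable_of_mono (P := fun d k => g^[k + d] x ≤ g^[k] y)
      (fun d k h => by
        rw [add_right_comm, Function.iterate_succ_apply', Function.iterate_succ_apply']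
        exact hg h)
      (fun d k h => (hg.antitone_iterate_of_map_le hx (Nat.le_succ (k + d))).trans h)
    obtain ⟨θ, hθ⟩ := exists_threshold (P := fun k => g^[k + N] x ≤ g^[k] y)
      (fun k h => by
        rw [add_right_comm, Function.iterate_succ_apply', Function.iterate_succ_apply']
        exact hg h)
    rcases θ with _ | m
    · exact ⟨N, 0, 0, 0, false, fun d hd k => by rw [hN d hd, hθ]; simp⟩
    · exact ⟨N, 0, 0, m, true, fun d hd k => by rw [hN d hd, hθ]; simp⟩
  · have mono := hg.monotone_iterate_of_le_map hx
    obtain ⟨N, hN⟩ := exists_stable_of_mono (P := fun d k => g^[k] y ≤ g^[k + d] x)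
      (fun d k h => by
        rw [add_right_comm, Function.iterate_succ_apply', Function.iterate_succ_apply']
        exact hg h)
      (fun d k h => h.trans (mono (Nat.le_succ (k + d))))
    obtain ⟨θ, hθ⟩ := exists_threshold (P := fun k => g^[k] y ≤ g^[k + N] x)
      (fun k h => by
        rw [add_right_comm, Function.iterate_succ_apply', Function.iterate_succ_apply']
        exact hg h)
    rcases θ with _ | t
    · refine ⟨N, 0, 0, 0, true, fun d hd k => iff_of_true ?_ (by simp)⟩
      have := mt ((hN d hd k).trans (hθ k)).1 (by simp)
      exact (not_le.1 this).le
    have ht : ∀ d, N ≤ d → ∀ k, g^[k] y ≤ g^[k + d] x ↔ t ≤ k := by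
      intro d hd k
      rw [hN d hd, hθ]
      simp
    -- Starting at N + 1 traps two consecutive terms of the orbit of x, with shifts N and N + 1, at
    -- the value `g^[k] y`; that value is therefore fixed.
    have key : ∀ d, N + 1 ≤ d → ∀ k, t ≤ k → g^[k + d] x ≤ g^[k] y →
        g (g^[k] y) = g^[k] y ∧ g^[k + d] x = g^[k] y := by
      intro d hd k hk h
      have h₁ := (ht N le_rfl k).2 hk
      have h₂ := (ht (N + 1) (by omega) k).2 hk
      have h₃ : g^[k + N] x = g^[k] y :=
        le_antisymm ((mono (by omega : k + N ≤ k + d)).trans h) h₁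
      have h₄ : g^[k + (N + 1)] x = g^[k] y :=
        le_antisymm ((mono (by omega : k + (N + 1) ≤ k + d)).trans h) h₂
      refine ⟨?_, le_antisymm h ((ht d (by omega) k).2 hk)⟩
      rw [← add_assoc, Function.iterate_succ_apply', h₃] at h₄
      exact h₄
    by_cases hE : ∃ d k, N + 1 ≤ d ∧ t ≤ k ∧ g^[k + d] x ≤ g^[k] y
    · obtain ⟨d₀, k₀, hd₀, hk₀, hle⟩ := hE
      obtain ⟨hp, hxp⟩ := key d₀ hd₀ k₀ hk₀ hle
      generalize hpy : g^[k₀] y = p at hp hxp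
      have hstep : ∀ z k, g^[k] z = p → g^[k + 1] z = p := fun z k h => by
        rw [Function.iterate_succ_apply', h, hp]
      have hpers : ∀ z {k k'}, k ≤ k' → g^[k] z = p → g^[k'] z = p := fun z _ _ h hz =>
        Nat.le_induction hz (fun n _ ih => hstep z n ih) _ h
      obtain ⟨θ, hθx⟩ := exists_threshold (P := fun k => g^[k] x = p) (hstep x)
      obtain ⟨θ', hθy⟩ := exists_threshold (P := fun k => g^[k] y = p) (hstep y)
      obtain ⟨e, rfl, -⟩ := (hθx _).1 hxp
      obtain ⟨e', rfl, -⟩ := (hθy _).1 hpy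
      simp only [Option.some.injEq, exists_eq_left'] at hθx hθy
      refine ⟨N + 1, t, e, e', true, fun d hd k => ?_⟩
      rw [← hθx, ← hθy]
      constructor
      · intro h
        by_cases hk : k < t
        · exact .inl hk
        · obtain ⟨hq, hxq⟩ := key d hd k (not_lt.1 hk) h
          -- An orbit reaches at most one fixed point, so the one reached at k is p.
          have hqp : g^[k] y = p := by
            rcases le_total k k₀ with hkk | hkk
            · rw [← hpy, ← Nat.sub_add_cancel hkk, Function.iterate_add_apply,
                Function.iterate_fixed hq]
            · exact hpers y hkk hpy
          exact .inr ⟨rfl, hxq.trans hqp, hqp⟩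
      · rintro (hk | ⟨-, h₁, h₂⟩)
        · exact (not_le.1 (mt (ht d (by omega) k).1 (not_le.2 hk))).le
        · exact (h₁.trans h₂.symm).le
    · push Not at hE
      refine ⟨N + 1, t, 0, 0, false, fun d hd k => ?_⟩
      simp only [Bool.false_eq_true, false_and, or_false]
      constructor
      · intro h
        by_contra hk
        exact absurd h (not_le.2 (hE d k hd (not_lt.1 hk)))
      · intro hk
        exact (not_le.1 (mt (ht d (by omega) k).1 (not_le.2 hk))).le

/-- Finite data describing a comparison between two orbits of a monotone map. -/
abbrev OrbitCode : Type := (Σ N : ℕ, Fin N → Option ℕ) × ℕ × ℕ × ℕ × Bool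

/-- The comparison described by an orbit code. -/
def OrbitCode.Holds (c : OrbitCode) (d k : ℕ) : Prop :=
  (∃ h : d < c.1.1, ∃ m, c.1.2 ⟨d, h⟩ = some m ∧ m ≤ k) ∨
    c.1.1 ≤ d ∧ (k < c.2.1 ∨ (c.2.2.2.2 = true ∧ c.2.2.1 ≤ k + d ∧ c.2.2.2.1 ≤ k))

/-- Each of the finitely many small shifts d < N has its own threshold in k; the tail is given by
`exists_tail_comparison`. -/
theorem exists_orbitCode (hg : Monotone g) (x y : A) :
    ∃ c : OrbitCode, ∀ d k, g^[k + d] x ≤ g^[k] y ↔ c.Holds d k := by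
  obtain ⟨N, t, e, e', β, h⟩ := exists_tail_comparison hg x y
  have hτ : ∀ d, ∃ θ : Option ℕ, ∀ k, g^[k + d] x ≤ g^[k] y ↔ ∃ m, θ = some m ∧ m ≤ k := fun d =>
    exists_threshold fun k hk => by
      rw [add_right_comm, Function.iterate_succ_apply', Function.iterate_succ_apply']
      exact hg hk
  choose τ hτ using hτ
  refine ⟨⟨⟨N, fun d => τ d⟩, t, e, e', β⟩, fun d k => ?_⟩
  unfold OrbitCode.Holds
  by_cases hd : d < N
  · rw [hτ d k]
    simp [hd, not_le.2 hd]
  · rw [h d (not_lt.1 hd)]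
    simp [hd, not_lt.1 hd]

theorem exists_orbitCode_dual (hg : Monotone g) (x y : A) :
    ∃ c : OrbitCode, ∀ d k, g^[k] x ≤ g^[k + d] y ↔ c.Holds d k :=
  @exists_orbitCode Aᵒᵈ _ g hg.dual y x

end OrbitComparison

/-! ### Embeddings determined by comparisons of iterates of generators -/

section Isomorphisms

variable {F : Type} {A B : Type} [(lang F).Structure A] [(lang F).Structure B]

/-- A surjective embedding is an isomorphism. -/
theorem nonempty_equiv_of_surjective (e : A ↪[lang F] B) (he : Function.Surjective e) :
    Nonempty (A ≃[lang F] B) :=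
  ⟨{ toEquiv := Equiv.ofBijective e ⟨e.injective, he⟩
     map_fun' := e.map_fun
     map_rel' := e.map_rel }⟩

end Isomorphisms

section Tuples

variable {ι : Type} {A B : Type} [(lang Unit).Structure A] [(lang Unit).Structure B]

/-- By antisymmetry the comparisons also decide which iterates coincide, so sending each iterate of
`v j` to the same iterate of `w j` is well defined, injective and order reflecting. -/
theorem exists_embedding_closure [IsPartialOrder A (le (F := Unit) A)]
    [IsPartialOrder B (le (F := Unit) B)] (v : ι → A) (w : ι → B)
    (h : ∀ j l i k, le (F := Unit) A ((op A ())^[i] (v j)) ((op A ())^[k] (v l)) ↔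
      le (F := Unit) B ((op B ())^[i] (w j)) ((op B ())^[k] (w l))) :
    ∃ e : Substructure.closure (lang Unit) (Set.range v) ↪[lang Unit] B,
      ∀ j, e ⟨v j, Substructure.subset_closure ⟨j, rfl⟩⟩ = w j := by
  choose J I hJI using fun x : Substructure.closure (lang Unit) (Set.range v) =>
    (mem_closure_range v _).1 x.2
  let f : Substructure.closure (lang Unit) (Set.range v) → B := fun x => (op B ())^[I x] (w (J x))
  have eq_of : ∀ {j l i k}, (op A ())^[i] (v j) = (op A ())^[k] (v l) →
      (op B ())^[i] (w j) = (op B ())^[k] (w l) := by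
    intro j l i k e
    exact antisymm_of (le (F := Unit) B) ((h _ _ _ _).1 (by rw [e]; exact refl_of _ _))
      ((h _ _ _ _).1 (by rw [e]; exact refl_of _ _))
  have hle : ∀ x y, le (F := Unit) B (f x) (f y) ↔
      le (F := Unit) (Substructure.closure (lang Unit) (Set.range v)) x y := by
    intro x y
    rw [← le_map (Substructure.subtype _), ← h]
    simp only [hJI, Substructure.subtype_apply]
  refine ⟨mkEmbedding f ?_ ?_ hle, ?_⟩
  · intro x y e
    have h₁ := (hle x y).1 (by rw [e]; exact refl_of _ _)
    have h₂ := (hle y x).1 (by rw [e]; exact refl_of _ _)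
    rw [← le_map (Substructure.subtype _)] at h₁ h₂
    exact Subtype.ext (antisymm_of (le (F := Unit) A) h₁ h₂)
  · rintro ⟨⟩ x
    refine Eq.trans (eq_of (k := I x + 1) (l := J x) ?_) (Function.iterate_succ_apply' _ _ _)
    rw [Function.iterate_succ_apply', hJI, hJI, ← Substructure.subtype_apply, op_map]
    rfl
  · exact fun j => eq_of (i := I _) (k := 0) (hJI _)

theorem nonempty_equiv_of_le_iff [IsPartialOrder A (le (F := Unit) A)]
    [IsPartialOrder B (le (F := Unit) B)] (v : ι → A) (w : ι → B)
    (hv : Substructure.closure (lang Unit) (Set.range v) = ⊤)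
    (hw : Substructure.closure (lang Unit) (Set.range w) = ⊤)
    (h : ∀ j l i k, le (F := Unit) A ((op A ())^[i] (v j)) ((op A ())^[k] (v l)) ↔
      le (F := Unit) B ((op B ())^[i] (w j)) ((op B ())^[k] (w l))) :
    Nonempty (A ≃[lang Unit] B) := by
  obtain ⟨e, he⟩ := exists_embedding_closure v w h
  obtain ⟨s⟩ := nonempty_equiv_of_surjective e fun b => by
    obtain ⟨j, i, rfl⟩ := (mem_closure_range w b).1 (hw ▸ trivial)
    exact ⟨_, (op_iterate_map e i _).trans (congrArg _ (he j))⟩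
  rw [hv] at s
  exact ⟨s.comp Substructure.topEquiv.symm⟩

end Tuples

/-! ### Countably many isomorphism types -/

section Countability

theorem countable_quotient_of_code {L : FirstOrder.Language.{0, 0}} {P : StrClass L} {γ : Type}
    [Countable γ] (code : Bundled.{0} L.Structure → γ → Prop) (h : ∀ A ∈ P, ∃ c, code A c)
    (heq : ∀ A ∈ P, ∀ B ∈ P, ∀ c, code A c → code B c → Nonempty (A ≃[L] B)) :
    (Quotient.mk' '' P).Countable := by
  refine (Set.countable_range fun c : {c : γ // ∃ A ∈ P, code A c} =>
    (Quotient.mk' c.2.choose : Quotient equivSetoid)).mono ?_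
  rintro _ ⟨A, hA, rfl⟩
  obtain ⟨c, hc⟩ := h A hA
  have hex : ∃ A ∈ P, code A c := ⟨A, hA, hc⟩
  exact ⟨⟨c, hex⟩, Quotient.sound
    (heq _ hex.choose_spec.1 A hA c hex.choose_spec.2 hc)⟩

theorem countable_finPart {F : Type} [Finite F] (K : StrClass (lang F)) :
    (Quotient.mk' '' finPart K).Countable := by
  refine countable_quotient_of_code
    (γ := Σ n : ℕ, (F → Fin n → Fin n) × (Fin n → Fin n → Prop))
    (fun A c => ∃ e : A ≃ Fin c.1, (∀ i a, e (op A i a) = c.2.1 i (e a)) ∧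
      ∀ a b, le (F := F) A a b ↔ c.2.2 (e a) (e b)) ?_ ?_
  · rintro A ⟨-, hA⟩
    have e := Finite.equivFin A
    exact ⟨⟨Nat.card A, fun i a => e (op A i (e.symm a)),
      fun a b => le (F := F) A (e.symm a) (e.symm b)⟩, e, by simp, by simp⟩
  · rintro A - B - c ⟨e, he, he'⟩ ⟨e', hf, hf'⟩
    refine nonempty_equiv_of_surjective
      (mkEmbedding (e.trans e'.symm) (e.trans e'.symm).injective ?_ ?_)
      (e.trans e'.symm).surjective
    · intro i a
      apply e'.injective
      simp [he, hf]
    · intro a b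
      simp [he', hf']

/-- Only the square of the operation is assumed monotone, which covers the reversing case. Each
generator and its image start an orbit of the square, and orbit codes for all pairs of these orbits
determine the isomorphism type. -/
theorem countable_fgPart {K : StrClass (lang Unit)}
    (hK : ∀ A ∈ K, ∃ _ : LinearOrder A, (∀ a b, le (F := Unit) A a b ↔ a ≤ b) ∧
      Monotone (op (F := Unit) A ())^[2]) : (Quotient.mk' '' fgPart K).Countable := by
  refine countable_quotient_of_code
    (γ := Σ n : ℕ, Fin n × Fin 2 → Fin n × Fin 2 → OrbitCode × OrbitCode)
    (fun A c => ∃ v : Fin c.1 → A, Substructure.closure (lang Unit) (Set.range v) = ⊤ ∧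
      ∀ p q d k,
        (le (F := Unit) A (((op A ())^[2])^[k + d] ((op A ())^[p.2] (v p.1)))
          (((op A ())^[2])^[k] ((op A ())^[q.2] (v q.1))) ↔ (c.2 p q).1.Holds d k) ∧
        (le (F := Unit) A (((op A ())^[2])^[k] ((op A ())^[p.2] (v p.1)))
          (((op A ())^[2])^[k + d] ((op A ())^[q.2] (v q.1))) ↔ (c.2 p q).2.Holds d k)) ?_ ?_
  · rintro A ⟨hA, hfg⟩
    obtain ⟨_, hle, hmono⟩ := hK A hA
    obtain ⟨n, v, hv⟩ := Substructure.fg_iff_exists_fin_generating_family.1 hfg.out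
    choose c₁ hc₁ using fun p q : Fin n × Fin 2 => exists_orbitCode hmono
      ((op (F := Unit) A ())^[p.2] (v p.1)) ((op (F := Unit) A ())^[q.2] (v q.1))
    choose c₂ hc₂ using fun p q : Fin n × Fin 2 => exists_orbitCode_dual hmono
      ((op (F := Unit) A ())^[p.2] (v p.1)) ((op (F := Unit) A ())^[q.2] (v q.1))
    exact ⟨⟨n, fun p q => (c₁ p q, c₂ p q)⟩, v, hv, fun p q d k =>
      ⟨(hle _ _).trans (hc₁ p q d k), (hle _ _).trans (hc₂ p q d k)⟩⟩
  · rintro A ⟨hA, -⟩ B ⟨hB, -⟩ c ⟨v, hv, hvc⟩ ⟨w, hw, hwc⟩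
    have isPO : ∀ A ∈ K, IsPartialOrder A (le (F := Unit) A) := by
      intro A hA
      obtain ⟨_, hle, -⟩ := hK A hA
      simp only [isPartialOrder_iff, hle]
      exact ⟨le_refl, fun _ _ _ => le_trans, fun _ _ => le_antisymm⟩
    have := isPO A hA
    have := isPO B hB
    refine nonempty_equiv_of_le_iff v w hv hw fun j l i k => ?_
    -- An iterate of f is an iterate of f² applied to the point itself or to its image, according to
    -- parity.
    have split : ∀ {X : Type} (f : X → X) (i : ℕ) (x : X),
        f^[i] x = (f^[2])^[i / 2] (f^[((Fin.ofNat 2 i : Fin 2) : ℕ)] x) := by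
      intro X f i x
      rw [← Function.iterate_mul, ← Function.iterate_add_apply]
      congr 2
      simp only [Fin.ofNat]
      omega
    rw [split _ i (v j), split _ k (v l), split _ i (w j), split _ k (w l)]
    rcases le_total (i / 2) (k / 2) with h | h <;> obtain ⟨d, hd⟩ := Nat.exists_eq_add_of_le h <;>
      rw [hd]
    · exact (hvc (j, _) (l, _) d _).2.trans (hwc (j, _) (l, _) d _).2.symm
    · exact (hvc (j, _) (l, _) d _).1.trans (hwc (j, _) (l, _) d _).1.symm

theorem countable_fgPart_of_LOp {K : StrClass (lang Unit)} (hK : K ⊆ LOp) :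
    (Quotient.mk' '' fgPart K).Countable :=
  countable_fgPart fun _ hA => ⟨linearOrderOf (hK hA).1, fun _ _ => Iff.rfl,
    fun _ _ h => (hK hA).2 _ _ ((hK hA).2 _ _ h)⟩

theorem countable_fgPart_of_LOr {K : StrClass (lang Unit)} (hK : K ⊆ LOr) :
    (Quotient.mk' '' fgPart K).Countable :=
  countable_fgPart fun _ hA => ⟨linearOrderOf (hK hA).1, fun _ _ => Iff.rfl,
    fun _ _ h => (hK hA).2 _ _ ((hK hA).2 _ _ h)⟩

end Countability

/-! ### Transfer of formulas to models of the complete theory -/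

section Closing

variable {L : FirstOrder.Language.{0, 0}} {ι : Type} [Finite ι]

/-- The universal closure of a formula. -/
noncomputable def univClosure (χ : L.Formula ι) : L.Sentence :=
  (χ.relabel (Sum.inr : ι → Empty ⊕ ι)).iAlls ι

theorem realize_univClosure {N : Type*} [L.Structure N] (χ : L.Formula ι) :
    N ⊨ univClosure χ ↔ ∀ v : ι → N, χ.Realize v := by
  unfold univClosure Sentence.Realize
  rw [Formula.realize_iAlls]
  simp only [Formula.realize_relabel]
  rfl

theorem realize_of_completeTheory {M : Type} [L.Structure M] {N : Type*} [L.Structure N]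
    (hN : N ⊨ L.completeTheory M) (χ : L.Formula ι) (h : ∀ v : ι → M, χ.Realize v) (v : ι → N) :
    χ.Realize v :=
  (realize_univClosure χ).1 (hN.realize_of_mem _ ((realize_univClosure χ).2 h)) v

theorem isQF_iInf {α β : Type} [Finite β] {f : β → L.Formula α} (h : ∀ b, (f b).IsQF) :
    (Formula.iInf f).IsQF := by
  have key (l : List β) : ((l.map f).foldr (· ⊓ ·) ⊤ : L.Formula α).IsQF := by
    induction l with
    | nil => exact BoundedFormula.IsQF.top
    | cons b l ih => exact (h b).inf ih
  exact key _

theorem isQF_iSup {α β : Type} [Finite β] {f : β → L.Formula α} (h : ∀ b, (f b).IsQF) :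
    (Formula.iSup f).IsQF := by
  have key (l : List β) : ((l.map f).foldr (· ⊔ ·) ⊥ : L.Formula α).IsQF := by
    induction l with
    | nil => exact BoundedFormula.isQF_bot
    | cons b l ih => exact (h b).sup ih
  exact key _

end Closing

/-! ### Quantifier-free types when the iterates are eventually 2-periodic -/

section Types

variable {ι : Type} {A B : Type} [(lang Unit).Structure A] [(lang Unit).Structure B] (m : ℕ)

theorem realize_iterTerm (k : ℕ) (v : Empty ⊕ Fin 1 → A) :
    (iterTerm k).realize v = (op A ())^[k] (v (Sum.inr 0)) := by
  induction k with
  | zero => rfl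
  | succ k ih =>
    rw [iterTerm, Term.realize_functions_apply₁, ih, Function.iterate_succ_apply']
    rfl

theorem realize_iterSentence :
    A ⊨ iterSentence m ↔ ∀ a : A, (op A ())^[m + 2] a = (op A ())^[m] a := by
  unfold iterSentence Sentence.Realize Formula.Realize
  simp only [BoundedFormula.realize_all, BoundedFormula.realize_bdEqual, realize_iterTerm]
  rfl

/-- The `i`-th iterate of a map satisfying `f ^ (m + 2) = f ^ m` is its `periodicIndex m i`-th
iterate. -/
def periodicIndex : ℕ → Fin (m + 2)
  | 0 => 0
  | i + 1 => if h : (periodicIndex i : ℕ) + 1 < m + 2 then ⟨_, h⟩ else ⟨m, by omega⟩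

theorem iterate_periodicIndex {X : Type} {f : X → X} (h : ∀ a, f^[m + 2] a = f^[m] a) (i : ℕ)
    (a : X) : f^[i] a = f^[periodicIndex m i] a := by
  induction i with
  | zero => rfl
  | succ i ih =>
    rw [Function.iterate_succ_apply', ih, ← Function.iterate_succ_apply' f, periodicIndex]
    split_ifs with hi
    · rfl
    · have : (periodicIndex m i : ℕ) + 1 = m + 2 := by omega
      rw [Nat.succ_eq_add_one, this, h]

/-- The quantifier-free type of a tuple. -/
def tupleType (v : ι → A) : ι → ι → Fin (m + 2) → Fin (m + 2) → Prop := fun j l i k =>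
  le (F := Unit) A ((op A ())^[i] (v j)) ((op A ())^[k] (v l))

variable {m}

theorem le_iff_of_tupleType_eq (hA : ∀ a : A, (op A ())^[m + 2] a = (op A ())^[m] a)
    (hB : ∀ b : B, (op B ())^[m + 2] b = (op B ())^[m] b) {v : ι → A} {w : ι → B}
    (h : tupleType m v = tupleType m w) (j l : ι) (i k : ℕ) :
    le (F := Unit) A ((op A ())^[i] (v j)) ((op A ())^[k] (v l)) ↔
      le (F := Unit) B ((op B ())^[i] (w j)) ((op B ())^[k] (w l)) := by
  rw [iterate_periodicIndex m hA i, iterate_periodicIndex m hA k, iterate_periodicIndex m hB i,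
    iterate_periodicIndex m hB k]
  exact iff_of_eq (congrFun (congrFun (congrFun (congrFun h j) l) _) _)

theorem tupleType_map (e : A ↪[lang Unit] B) (v : ι → A) :
    tupleType m (e ∘ v) = tupleType m v := by
  funext j l i k
  simp only [tupleType, Function.comp_apply, ← op_iterate_map, le_map]

/-- The term `f ^ k (x_j)`. -/
def varIter (j : ι) : ℕ → (lang Unit).Term ι
  | 0 => Term.var j
  | k + 1 => (opSymb ()).apply₁ (varIter j k)

theorem realize_varIter (j : ι) (k : ℕ) (v : ι → A) :
    (varIter j k).realize v = (op A ())^[k] (v j) := by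
  induction k with
  | zero => rfl
  | succ k ih =>
    rw [varIter, Term.realize_functions_apply₁, ih, Function.iterate_succ_apply']
    rfl

variable [Finite ι]

open Classical in
/-- The formula saying that the type of a tuple is `t`. -/
noncomputable def typeFormula (t : ι → ι → Fin (m + 2) → Fin (m + 2) → Prop) :
    (lang Unit).Formula ι :=
  Formula.iInf fun p : (ι × ι) × Fin (m + 2) × Fin (m + 2) =>
    if t p.1.1 p.1.2 p.2.1 p.2.2 then
      (leSymb : (lang Unit).Relations 2).formula₂ (varIter p.1.1 p.2.1) (varIter p.1.2 p.2.2)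
    else ((leSymb : (lang Unit).Relations 2).formula₂ (varIter p.1.1 p.2.1)
      (varIter p.1.2 p.2.2)).not

theorem realize_typeFormula (t : ι → ι → Fin (m + 2) → Fin (m + 2) → Prop) (v : ι → A) :
    (typeFormula t).Realize v ↔ tupleType m v = t := by
  have hle : ∀ (j l : ι) (i k : ℕ), ((leSymb : (lang Unit).Relations 2).formula₂
      (varIter j i) (varIter l k)).Realize v ↔
      le (F := Unit) A ((op A ())^[i] (v j)) ((op A ())^[k] (v l)) := by
    intro j l i k
    rw [Formula.realize_rel₂, realize_varIter, realize_varIter]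
    rfl
  rw [typeFormula, Formula.realize_iInf]
  constructor
  · intro h
    funext j l i k
    have := h ((j, l), i, k)
    simp only at this
    split_ifs at this with ht
    · exact propext (iff_of_true ((hle _ _ _ _).1 this) ht)
    · rw [Formula.realize_not, hle] at this
      exact propext (iff_of_false this ht)
  · rintro rfl ⟨⟨j, l⟩, i, k⟩
    simp only
    split_ifs with ht
    · exact (hle _ _ _ _).2 ht
    · rw [Formula.realize_not, hle]
      exact ht

/-- The formula saying that the type of a tuple belongs to `T`. -/
noncomputable def typesFormula (T : Set (ι → ι → Fin (m + 2) → Fin (m + 2) → Prop)) :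
    (lang Unit).Formula ι :=
  Formula.iSup fun t : T => typeFormula t.1

theorem realize_typesFormula (T : Set (ι → ι → Fin (m + 2) → Fin (m + 2) → Prop)) (v : ι → A) :
    (typesFormula T).Realize v ↔ tupleType m v ∈ T := by
  simp [typesFormula, realize_typeFormula]

theorem isQF_typesFormula (T : Set (ι → ι → Fin (m + 2) → Fin (m + 2) → Prop)) :
    (typesFormula T).IsQF := by
  refine isQF_iSup fun t => isQF_iInf fun p => ?_
  split_ifs
  · exact (BoundedFormula.IsAtomic.rel _ _).isQF
  · exact (BoundedFormula.IsAtomic.rel _ _).isQF.not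

end Types

/-! ### Quantifier elimination and back and forth -/

section Homogeneous

variable {ι : Type} [Finite ι] {m : ℕ} {M : Type} [(lang Unit).Structure M]

theorem exists_automorphism (hM : IsUltrahomogeneous (lang Unit) M)
    [IsPartialOrder M (le (F := Unit) M)] (hm : M ⊨ iterSentence m)
    {v w : ι → M} (h : tupleType m v = tupleType m w) : ∃ g : M ≃[lang Unit] M, g ∘ v = w := by
  rw [realize_iterSentence] at hm
  obtain ⟨e, he⟩ := exists_embedding_closure v w (le_iff_of_tupleType_eq hm hm h)
  obtain ⟨g, hg⟩ := hM _ (Substructure.fg_closure (Set.finite_range v)) e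
  refine ⟨g, funext fun j => ?_⟩
  rw [← he j, hg]
  rfl

/-- Tuples of equal type are conjugate under automorphisms, which preserve truth, so the types
realized by solutions of the formula tell exactly which tuples satisfy it. -/
theorem exists_types (hM : IsUltrahomogeneous (lang Unit) M)
    [IsPartialOrder M (le (F := Unit) M)] (hm : M ⊨ iterSentence m) (φ : (lang Unit).Formula ι) :
    ∃ T : Set (ι → ι → Fin (m + 2) → Fin (m + 2) → Prop), ∀ v : ι → M,
      φ.Realize v ↔ tupleType m v ∈ T := by
  refine ⟨{t | ∃ w : ι → M, φ.Realize w ∧ tupleType m w = t}, fun v => ⟨fun h => ⟨v, h, rfl⟩, ?_⟩⟩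
  rintro ⟨w, hw, hwv⟩
  obtain ⟨g, rfl⟩ := exists_automorphism hM hm hwv
  exact (StrongHomClass.realize_formula g φ).2 hw

/-- There are finitely many types, so membership of the type in T is itself a formula, and its
equivalence with φ is one sentence of Th(M). Hence the same T serves in every model. -/
theorem exists_types_completeTheory (hM : IsUltrahomogeneous (lang Unit) M)
    [IsPartialOrder M (le (F := Unit) M)] (hm : M ⊨ iterSentence m) (φ : (lang Unit).Formula ι) :
    ∃ T : Set (ι → ι → Fin (m + 2) → Fin (m + 2) → Prop), ∀ (N : Type) [(lang Unit).Structure N],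
      N ⊨ (lang Unit).completeTheory M → ∀ v : ι → N, φ.Realize v ↔ tupleType m v ∈ T := by
  obtain ⟨T, hT⟩ := exists_types hM hm φ
  refine ⟨T, fun N _ hN v => ?_⟩
  rw [← realize_typesFormula]
  refine Formula.realize_iff.1 (realize_of_completeTheory hN (φ.iff (typesFormula T)) ?_ v)
  exact fun v => Formula.realize_iff.2 ((hT v).trans (realize_typesFormula T v).symm)

theorem hasQE_of_isUltrahomogeneous (hM : IsUltrahomogeneous (lang Unit) M)
    [IsPartialOrder M (le (F := Unit) M)] (hm : M ⊨ iterSentence m) :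
    HasQE ((lang Unit).completeTheory M) := by
  intro n φ
  obtain ⟨T, hT⟩ := exists_types_completeTheory hM hm φ
  refine ⟨typesFormula T, isQF_typesFormula T, fun N v xs => ?_⟩
  rw [BoundedFormula.realize_iff]
  have := (hT N N.is_model v).trans (realize_typesFormula T v).symm
  rwa [Formula.Realize, Formula.Realize, ← Subsingleton.elim xs default] at this

/-- The existence of an element completing the tuple to a given type depends, by
`exists_types_completeTheory`, only on the type of the tuple; embeddings preserve types, so the new
element has a counterpart in C. -/
theorem isExtensionPair_of_completeTheory (hM : IsUltrahomogeneous (lang Unit) M)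
    [IsPartialOrder M (le (F := Unit) M)] (hm : M ⊨ iterSentence m)
    {B C : Type} [(lang Unit).Structure B] [(lang Unit).Structure C]
    [IsPartialOrder B (le (F := Unit) B)] [IsPartialOrder C (le (F := Unit) C)]
    (hB : B ⊨ (lang Unit).completeTheory M) (hC : C ⊨ (lang Unit).completeTheory M) :
    (lang Unit).IsExtensionPair B C := by
  rw [isExtensionPair_iff_exists_embedding_closure_singleton_sup]
  intro S hS f b
  obtain ⟨n, v, rfl⟩ := Substructure.fg_iff_exists_fin_generating_family.1 hS
  have hmB := (realize_iterSentence m).1 (hB.realize_of_mem _ hm)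
  have hmC := (realize_iterSentence m).1 (hC.realize_of_mem _ hm)
  let v' : Fin n → Substructure.closure (lang Unit) (Set.range v) := fun j =>
    ⟨v j, Substructure.subset_closure ⟨j, rfl⟩⟩
  let t := tupleType m (Sum.elim v fun _ : Unit => b)
  obtain ⟨T, hT⟩ := exists_types_completeTheory hM hm ((typeFormula t).iExs Unit)
  have h₁ : ((typeFormula t).iExs Unit).Realize v := by
    rw [Formula.realize_iExs]
    exact ⟨fun _ => b, (realize_typeFormula _ _).2 rfl⟩
  have h₂ : tupleType m (f ∘ v') = tupleType m v :=
    (tupleType_map f v').trans (tupleType_map (Substructure.subtype _) v').symm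
  have h₃ : ((typeFormula t).iExs Unit).Realize (f ∘ v') := by
    rw [hT C hC, h₂, ← hT B hB]
    exact h₁
  obtain ⟨c, hc⟩ := Formula.realize_iExs.1 h₃
  rw [realize_typeFormula] at hc
  obtain ⟨e, he⟩ := exists_embedding_closure _ _ (le_iff_of_tupleType_eq hmB hmC hc.symm)
  have hle : Substructure.closure (lang Unit) {b} ⊔ Substructure.closure (lang Unit) (Set.range v) ≤
      Substructure.closure (lang Unit) (Set.range (Sum.elim v fun _ : Unit => b)) := by
    refine sup_le ?_ ?_ <;> rw [Substructure.closure_le]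
    · rintro _ rfl
      exact Substructure.subset_closure ⟨.inr (), rfl⟩
    · rintro _ ⟨j, rfl⟩
      exact Substructure.subset_closure ⟨.inl j, rfl⟩
  refine ⟨e.comp (Substructure.inclusion hle), ?_⟩
  ext ⟨x, hx⟩
  obtain ⟨j, i, rfl⟩ := (mem_closure_range v x).1 hx
  have hx' : (⟨_, hx⟩ : Substructure.closure (lang Unit) (Set.range v)) = (op _ ())^[i] (v' j) := by
    apply Subtype.ext
    exact (op_iterate_map (Substructure.subtype _) i (v' j)).symm
  rw [hx', op_iterate_map, op_iterate_map]
  exact congrArg _ (he (.inl j)).symm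

theorem nonempty_equiv_of_completeTheory (hM : IsUltrahomogeneous (lang Unit) M)
    [IsPartialOrder M (le (F := Unit) M)] (hm : M ⊨ iterSentence m)
    {B C : Type} [(lang Unit).Structure B] [(lang Unit).Structure C]
    [IsPartialOrder B (le (F := Unit) B)] [IsPartialOrder C (le (F := Unit) C)]
    [Countable B] [Countable C]
    (hB : B ⊨ (lang Unit).completeTheory M) (hC : C ⊨ (lang Unit).completeTheory M) :
    Nonempty (B ≃[lang Unit] C) := by
  obtain ⟨e, -⟩ := equiv_between_cg Structure.cg_of_countable Structure.cg_of_countable default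
    (isExtensionPair_of_completeTheory hM hm hB hC) (isExtensionPair_of_completeTheory hM hm hC hB)
  exact ⟨e⟩

end Homogeneous

/-! ### Embedding into an ultrapower -/

section Ultrapower

variable {L : FirstOrder.Language.{0, 0}}

/-- Embeddings chosen for all finite subsets of A combine into a map to the ultrapower indexed by
these subsets, since any finite amount of information about A is seen by almost all of them; the
ultrapower satisfies Th(M) by Łoś. -/
theorem exists_embedding_ultrapower {A M : Type} [L.Structure A] [L.Structure M] [Nonempty M]
    (h : ∀ s : Finset A, Nonempty (Substructure.closure L (s : Set A) ↪[L] M)) :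
    ∃ B : Bundled.{0} L.Structure, B ⊨ L.completeTheory M ∧ Nonempty (A ↪[L] B) := by
  classical
  let e := fun s : Finset A => (h s).some
  -- An ultrafilter finer than `atTop` contains, for each a, the family of finite sets having a as
  -- an element.
  let U : Ultrafilter (Finset A) := Ultrafilter.of Filter.atTop
  have hU : ∀ a : A, ∀ᶠ s : Finset A in (U : Filter (Finset A)), a ∈ Substructure.closure L (s : Set A) := by
    intro a
    refine Ultrafilter.of_le _ ((Filter.eventually_ge_atTop {a}).mono fun s hs => ?_)
    exact Substructure.subset_closure (hs (Finset.mem_singleton_self a))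
  let g : A → Finset A → M := fun a s =>
    if ha : a ∈ Substructure.closure L (s : Set A) then e s ⟨a, ha⟩ else Classical.arbitrary M
  have hg : ∀ {a} {s : Finset A} (ha : a ∈ Substructure.closure L (s : Set A)), g a s = e s ⟨a, ha⟩ :=
    fun ha => dif_pos ha
  let f : A → (U : Filter (Finset A)).Product fun _ => M := fun a =>
    Quotient.mk ((U : Filter (Finset A)).productSetoid fun _ => M) (g a)
  refine ⟨⟨(U : Filter (Finset A)).Product fun _ => M, inferInstance⟩, ⟨fun φ hφ => ?_⟩,
    ⟨{ toFun := f, inj' := fun a b hab => ?_, map_fun' := ?_, map_rel' := ?_ }⟩⟩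
  · exact (Ultraproduct.sentence_realize φ).2 (Filter.Eventually.of_forall fun _ => hφ)
  · have hab' : ∀ᶠ s in (U : Filter (Finset A)), g a s = g b s := Quotient.eq''.1 hab
    obtain ⟨s, hs, ha, hb⟩ := (hab'.and ((hU a).and (hU b))).exists
    rw [hg ha, hg hb] at hs
    exact congrArg Subtype.val ((e s).injective hs)
  · intro n F x
    refine Eq.trans ?_ (Ultraproduct.funMap_cast (u := U) F fun i => g (x i)).symm
    refine Quotient.eq''.2 ?_
    filter_upwards [Filter.eventually_all.2 fun i => hU (x i)] with s hs
    have hF := (Substructure.closure L (s : Set A)).fun_mem F x hs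
    simp only [hg hF, hg (hs _)]
    exact (e s).map_fun F fun i => ⟨x i, hs i⟩
  · intro n R x
    have hx := Filter.eventually_all.2 fun i => hU (x i)
    have hR : ∀ s : Finset A, (∀ i, x i ∈ Substructure.closure L (s : Set A)) →
        (Structure.RelMap R (fun i => g (x i) s) ↔ Structure.RelMap R x) := by
      intro s hs
      simp only [hg (hs _)]
      exact (e s).map_rel R fun i => ⟨x i, hs i⟩
    refine (relMap_quotient_mk' _ R fun i => g (x i)).trans ⟨fun hr => ?_, fun hr => ?_⟩
    · obtain ⟨s, hs, hs'⟩ := (Filter.Eventually.and hr hx).exists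
      exact (hR s hs').1 hs
    · exact hx.mono fun s hs => (hR s hs).2 hr

end Ultrapower

/-! ### Axioms of the linear classes -/

section Axioms

variable {F : Type} {A : Type} [(lang F).Structure A]

/-- The sentence saying that the operation `i` is order preserving. -/
def preservingSentence (i : F) : (lang F).Sentence :=
  (((leSymb : (lang F).Relations 2).boundedFormula₂ (Term.var (Sum.inr 0) : (lang F).Term (Empty ⊕ Fin 2))
    (Term.var (Sum.inr 1))).imp
    ((leSymb : (lang F).Relations 2).boundedFormula₂
      ((opSymb i).apply₁ (Term.var (Sum.inr 0)))
      ((opSymb i).apply₁ (Term.var (Sum.inr 1))))).all.all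

/-- The sentence saying that the operation `i` is order reversing. -/
def reversingSentence (i : F) : (lang F).Sentence :=
  (((leSymb : (lang F).Relations 2).boundedFormula₂ (Term.var (Sum.inr 0) : (lang F).Term (Empty ⊕ Fin 2))
    (Term.var (Sum.inr 1))).imp
    ((leSymb : (lang F).Relations 2).boundedFormula₂
      ((opSymb i).apply₁ (Term.var (Sum.inr 1)))
      ((opSymb i).apply₁ (Term.var (Sum.inr 0))))).all.all

theorem realize_preservingSentence (i : F) :
    A ⊨ preservingSentence i ↔ OrderPreserving A i := by
  refine forall₂_congr fun a b => ?_
  rw [BoundedFormula.realize_imp, BoundedFormula.realize_rel₂, BoundedFormula.realize_rel₂]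
  rw [Term.realize_functions_apply₁, Term.realize_functions_apply₁]
  rfl

theorem realize_reversingSentence (i : F) :
    A ⊨ reversingSentence i ↔ OrderReversing A i := by
  refine forall₂_congr fun a b => ?_
  rw [BoundedFormula.realize_imp, BoundedFormula.realize_rel₂, BoundedFormula.realize_rel₂]
  rw [Term.realize_functions_apply₁, Term.realize_functions_apply₁]
  rfl

/-- Every class of linear orders axiomatized relative to all linear orders contains the models
of its theory. -/
theorem mem_of_models_classTheory {K : StrClass (lang F)} (T : (lang F).Theory)
    (hK : ∀ A : Bundled.{0} (lang F).Structure,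
      A ∈ K ↔ IsLinearOrder A (le (F := F) A) ∧ ∀ φ ∈ T, A ⊨ φ)
    (A : Bundled.{0} (lang F).Structure) (hA : A ⊨ classTheory K) : A ∈ K := by
  have key : ∀ φ : (lang F).Sentence, (∀ B ∈ K, B ⊨ φ) → A ⊨ φ := fun φ h => hA.realize_of_mem φ h
  have h₁ := key (leSymb : (lang F).Relations 2).reflexive fun B hB =>
    Relations.realize_reflexive.2 ((hK B).1 hB).1.toRefl
  have h₂ := key (leSymb : (lang F).Relations 2).transitive fun B hB =>
    Relations.realize_transitive.2 ((hK B).1 hB).1.toIsTrans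
  have h₃ := key (leSymb : (lang F).Relations 2).antisymmetric fun B hB =>
    Relations.realize_antisymmetric.2 ((hK B).1 hB).1.toAntisymm
  have h₄ := key (leSymb : (lang F).Relations 2).total fun B hB =>
    Relations.realize_total.2 ((hK B).1 hB).1.toTotal
  rw [Relations.realize_reflexive] at h₁
  rw [Relations.realize_transitive] at h₂
  rw [Relations.realize_antisymmetric] at h₃
  rw [Relations.realize_total] at h₄
  refine (hK A).2 ⟨?_, fun φ hφ => key φ fun B hB => ((hK B).1 hB).2 φ hφ⟩
  exact isLinearOrder_iff.2 ⟨isPartialOrder_iff.2 ⟨h₁.refl, h₂.trans, h₃.antisymm⟩, h₄.total⟩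

end Axioms

/-! ### The theory of the limit -/

section Limit

variable {K : StrClass (lang Unit)} {m : ℕ} {M : Bundled.{0} (lang Unit).Structure}

theorem classTheory_subset_completeTheory {L : FirstOrder.Language.{0, 0}} {K : StrClass L}
    {M : Bundled.{0} L.Structure} (hMK : M ∈ K) : classTheory K ⊆ L.completeTheory M :=
  fun _ hφ => hφ M hMK

/-- A countably infinite model in any universe is moved to the carrier ℕ, so that it can be compared
with the structures of the classes. -/
theorem exists_countable_copy {L : FirstOrder.Language.{0, 0}} {N : Type*} [L.Structure N]
    (hN : Cardinal.mk N = Cardinal.aleph0) :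
    ∃ B : Bundled.{0} L.Structure, Countable B ∧ Nonempty (N ≃[L] B) := by
  obtain ⟨_⟩ := Cardinal.denumerable_iff.2 hN
  let e := Denumerable.eqv N
  exact ⟨⟨ℕ, Equiv.inducedStructure e⟩, inferInstanceAs (Countable ℕ),
    ⟨Equiv.inducedStructureEquiv e⟩⟩

theorem categorical_completeTheory (hax : ∀ A : Bundled.{0} (lang Unit).Structure, A ⊨ classTheory K → A ∈ K)
    (hPO : ∀ A ∈ K, IsPartialOrder A (le (F := Unit) A)) (hit : ∀ A ∈ K, A ⊨ iterSentence m)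
    (hMK : M ∈ K) (hM : IsUltrahomogeneous (lang Unit) M) :
    Cardinal.aleph0.Categorical ((lang Unit).completeTheory M) := by
  intro N₁ N₂ h₁ h₂
  obtain ⟨B, _, ⟨e₁⟩⟩ := exists_countable_copy (L := lang Unit) h₁
  obtain ⟨C, _, ⟨e₂⟩⟩ := exists_countable_copy (L := lang Unit) h₂
  have hB : B ⊨ (lang Unit).completeTheory M := (StrongHomClass.elementarilyEquivalent e₁).theory_model_iff.1 N₁.is_model
  have hC : C ⊨ (lang Unit).completeTheory M := (StrongHomClass.elementarilyEquivalent e₂).theory_model_iff.1 N₂.is_model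
  have hsub := classTheory_subset_completeTheory hMK
  have := hPO M hMK
  have := hPO B (hax B (hB.mono hsub))
  have := hPO C (hax C (hC.mono hsub))
  obtain ⟨e⟩ := nonempty_equiv_of_completeTheory hM (hit M hMK) hB hC
  exact ⟨e₂.symm.comp (e.comp e₁)⟩

/-- Every iterate of a generator is one of its first m + 2 iterates, so finitely generated
substructures are finite and thus belong to the age of the limit. -/
theorem finite_closure {A : Type} [(lang Unit).Structure A] (hA : A ⊨ iterSentence m) {s : Set A}
    (hs : s.Finite) : Finite (Substructure.closure (lang Unit) s) := by
  have := hs.to_subtype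
  rw [realize_iterSentence] at hA
  refine Finite.of_surjective (α := s × Fin (m + 2))
    (fun p => ⟨(op A ())^[p.2] p.1, ?_⟩) ?_
  · have := (mem_closure_range ((↑) : s → A) _).2 ⟨p.1, p.2, rfl⟩
    rwa [Subtype.range_coe] at this
  · rintro ⟨x, hx⟩
    rw [← Subtype.range_coe (s := s), mem_closure_range] at hx
    obtain ⟨a, i, rfl⟩ := hx
    exact ⟨(a, periodicIndex m i), Subtype.ext (iterate_periodicIndex m hA i a).symm⟩

theorem isModelCompletion_completeTheory (hax : ∀ A : Bundled.{0} (lang Unit).Structure, A ⊨ classTheory K → A ∈ K)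
    (hK : IsLocal K) (hPO : ∀ A ∈ K, IsPartialOrder A (le (F := Unit) A))
    (hit : ∀ A ∈ K, A ⊨ iterSentence m) (hMK : M ∈ K) [Countable M]
    (hM : IsFraisseLimit (finPart K) M) :
    IsModelCompletion ((lang Unit).completeTheory M) (classTheory K) where
  extends_base B hB := hB.mono (classTheory_subset_completeTheory hMK)
  exists_embedding A hA := by
    have hAK := hax A hA
    have hemb : ∀ s : Finset A,
        Nonempty (Substructure.closure (lang Unit) (s : Set A) ↪[lang Unit] M) := by
      intro s
      have : (⟨Substructure.closure (lang Unit) (s : Set A), inferInstance⟩ :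
          Bundled.{0} (lang Unit).Structure) ∈ finPart K :=
        ⟨hK.of_embedding _ A hAK (Substructure.subtype _),
          finite_closure (hit A hAK) s.finite_toSet⟩
      rw [← hM.age] at this
      exact this.2
    -- The ultrapower needs M nonempty, which follows by embedding the closure of a point; an empty
    -- A embeds in M itself.
    by_cases hne : Nonempty A
    · obtain ⟨a⟩ := hne
      obtain ⟨e⟩ := hemb {a}
      have : Nonempty M := ⟨e ⟨a, Substructure.subset_closure (by simp)⟩⟩
      exact exists_embedding_ultrapower hemb
    · rw [not_nonempty_iff] at hne
      exact ⟨M, ⟨fun _ h => h⟩, ⟨mkEmbedding (fun a => isEmptyElim a)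
        (fun a => isEmptyElim a) (fun _ a => isEmptyElim a) (fun a => isEmptyElim a)⟩⟩
  diagram_complete A B C _ hB hC i j n φ v := by
    have := hPO M hMK
    -- In B and in C the truth of φ at v depends only on the type of v, which both embeddings
    -- preserve.
    obtain ⟨T, hT⟩ := exists_types_completeTheory hM.ultrahomogeneous (hit M hMK) φ
    rw [hT B hB, hT C hC, tupleType_map, tupleType_map]

end Limit

/-! ### Assembling the theorem -/

section Main

theorem mem_of_models_classTheory_LOp {H : Set (lang Unit).Sentence} (A : Bundled.{0} (lang Unit).Structure)
    (hA : A ⊨ classTheory (withCond LOp H)) : A ∈ withCond LOp H := by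
  refine mem_of_models_classTheory (insert (preservingSentence ()) H) (fun A => ?_) A hA
  rw [Set.forall_mem_insert, realize_preservingSentence, ← and_assoc]
  rfl

theorem mem_of_models_classTheory_LOr {H : Set (lang Unit).Sentence} (A : Bundled.{0} (lang Unit).Structure)
    (hA : A ⊨ classTheory (withCond LOr H)) : A ∈ withCond LOr H := by
  refine mem_of_models_classTheory (insert (reversingSentence ()) H) (fun A => ?_) A hA
  rw [Set.forall_mem_insert, realize_reversingSentence, ← and_assoc]
  rfl

theorem exists_limit_fin_of_linear {K₀ : StrClass (lang Unit)} (hloc : IsLocal K₀)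
    (hU : UnionAmalgamation K₀) (hlin : ∀ A ∈ K₀, IsLinearOrder A (le (F := Unit) A))
    {H : Set (lang Unit).Sentence} (hH : ∀ φ ∈ H, IsOneUniversal φ)
    (hax : ∀ A : Bundled.{0} (lang Unit).Structure, A ⊨ classTheory (withCond K₀ H) → A ∈ withCond K₀ H)
    (hne : (finPart (withCond K₀ H)).Nonempty) :
    ∃ M ∈ withCond K₀ H, ∃ _ : Countable M,
      IsFraisseLimit (finPart (withCond K₀ H)) M ∧
      ((∃ m : ℕ, iterSentence m ∈ H) →
        Cardinal.aleph0.Categorical ((lang Unit).completeTheory M) ∧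
        HasQE ((lang Unit).completeTheory M) ∧
        IsModelCompletion ((lang Unit).completeTheory M) (classTheory (withCond K₀ H))) := by
  have hlocH := isLocal_withCond hloc hH
  obtain ⟨M, hMK, hc, hM⟩ := exists_limit_fin hlocH (hU.withCond hH) (countable_finPart _) hne
  refine ⟨M, hMK, hc, hM, ?_⟩
  rintro ⟨m, hm⟩
  have hPO : ∀ A ∈ withCond K₀ H, IsPartialOrder A (le (F := Unit) A) :=
    fun A hA => (hlin A hA.1).toIsPartialOrder
  have hit : ∀ A ∈ withCond K₀ H, A ⊨ iterSentence m := fun A hA => hA.2 _ hm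
  have := hPO M hMK
  exact ⟨categorical_completeTheory hax hPO hit hMK hM.ultrahomogeneous,
    hasQE_of_isUltrahomogeneous hM.ultrahomogeneous (hit M hMK),
    isModelCompletion_completeTheory hax hlocH hPO hit hMK hM⟩

theorem exists_limit_fg_withCond {K₀ : StrClass (lang Unit)} (hloc : IsLocal K₀)
    (hU : UnionAmalgamation K₀) (hK₀ : K₀ ⊆ LOp ∨ K₀ ⊆ LOr)
    {H : Set (lang Unit).Sentence} (hH : ∀ φ ∈ H, IsOneUniversal φ)
    (hne : (withCond K₀ H).Nonempty) :
    ∃ M ∈ withCond K₀ H, ∃ _ : Countable M, IsFraisseLimit (fgPart (withCond K₀ H)) M := by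
  have hsub : withCond K₀ H ⊆ K₀ := fun _ hA => hA.1
  refine exists_limit_fg (isLocal_withCond hloc hH) (hU.withCond hH) ?_ hne
  rcases hK₀ with h | h
  · exact countable_fgPart_of_LOp (hsub.trans h)
  · exact countable_fgPart_of_LOr (hsub.trans h)

end Main

end OrdOp

theorem theorem5p2 :
    -- (1) for linear orders, with the addendum on the theory of the limit
    (∀ H : Set (OrdOp.lang Unit).Sentence, (∀ φ ∈ H, OrdOp.IsOneUniversal φ) →
      ∀ K : OrdOp.StrClass (OrdOp.lang Unit),
        (K = OrdOp.withCond OrdOp.LOp H ∨ K = OrdOp.withCond OrdOp.LOr H) →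
        (OrdOp.finPart K).Nonempty →
        ∃ M ∈ K, ∃ _ : Countable M,
          IsFraisseLimit (OrdOp.finPart K) M ∧
          ((∃ m : ℕ, OrdOp.iterSentence m ∈ H) →
            Cardinal.aleph0.Categorical ((OrdOp.lang Unit).completeTheory M) ∧
            OrdOp.HasQE ((OrdOp.lang Unit).completeTheory M) ∧
            OrdOp.IsModelCompletion ((OrdOp.lang Unit).completeTheory M)
              (OrdOp.classTheory K))) ∧
    -- (1) for posets with finitely many operations
    (∀ (F : Type) [Finite F] (F₁ F₂ F₃ F₄ : Set F), F₁ ∪ F₂ ∪ F₃ ∪ F₄ = Set.univ →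
      ∀ H : Set (OrdOp.lang F).Sentence, (∀ φ ∈ H, OrdOp.IsOneUniversal φ) →
      ∀ K : OrdOp.StrClass (OrdOp.lang F),
        K = OrdOp.withCond (OrdOp.PO F₁ F₂ F₃ F₄) H →
        (OrdOp.finPart K).Nonempty →
        ∃ M ∈ K, ∃ _ : Countable M, IsFraisseLimit (OrdOp.finPart K) M) ∧
    -- (2)
    (∀ H : Set (OrdOp.lang Unit).Sentence, (∀ φ ∈ H, OrdOp.IsOneUniversal φ) →
      ∀ K : OrdOp.StrClass (OrdOp.lang Unit),
        (K = OrdOp.withCond OrdOp.LOp H ∨ K = OrdOp.withCond OrdOp.LOsp H ∨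
          K = OrdOp.withCond OrdOp.LOr H ∨ K = OrdOp.withCond OrdOp.LOsr H) →
        K.Nonempty →
        ∃ M ∈ K, ∃ _ : Countable M, IsFraisseLimit (OrdOp.fgPart K) M) := by
  refine ⟨?_, ?_, ?_⟩
  · rintro H hH K (rfl | rfl) hne
    · exact OrdOp.exists_limit_fin_of_linear OrdOp.isLocal_LOp OrdOp.unionAmalgamation_LOp
        (fun A hA => hA.1) hH OrdOp.mem_of_models_classTheory_LOp hne
    · exact OrdOp.exists_limit_fin_of_linear OrdOp.isLocal_LOr OrdOp.unionAmalgamation_LOr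
        (fun A hA => hA.1) hH OrdOp.mem_of_models_classTheory_LOr hne
  · rintro F _ F₁ F₂ F₃ F₄ hF H hH K rfl hne
    exact OrdOp.exists_limit_fin (OrdOp.isLocal_withCond (OrdOp.isLocal_PO F₁ F₂ F₃ F₄) hH)
      ((OrdOp.unionAmalgamation_PO hF).withCond hH) (OrdOp.countable_finPart _) hne
  · rintro H hH K (rfl | rfl | rfl | rfl) hne
    · exact OrdOp.exists_limit_fg_withCond OrdOp.isLocal_LOp OrdOp.unionAmalgamation_LOp
        (.inl subset_rfl) hH hne
    · exact OrdOp.exists_limit_fg_withCond OrdOp.isLocal_LOsp OrdOp.unionAmalgamation_LOsp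
        (.inl OrdOp.LOsp_subset_LOp) hH hne
    · exact OrdOp.exists_limit_fg_withCond OrdOp.isLocal_LOr OrdOp.unionAmalgamation_LOr
        (.inr subset_rfl) hH hne
    · exact OrdOp.exists_limit_fg_withCond OrdOp.isLocal_LOsr OrdOp.unionAmalgamation_LOsr
        (.inr OrdOp.LOsr_subset_LOr) hH hne
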